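/- Let $\Lambda=(-1,1)$, $\alpha>0$, and let $P_n^{\alpha,\alpha}$ be the Jacobi polynomials. For $n\ge 0$ put $$\phi_n(x)=\frac{\sqrt{2n+2\alpha+1}\;n!}{2^{\alpha+1/2}\,\Gamma(n+\alpha+1)}\,(1-x^2)^{\alpha}P_n^{\alpha,\alpha}(x)\quad(x\in\Lambda),\qquad \mathbb F_N=\operatorname{span}\{\phi_0,\dots,\phi_N\}.$$ For $s\ge 0$ let $H^s_*(\Lambda)$ be the space of all $v\in L^2(\Lambda)$ whose extension by zero $\tilde v$ lies in $H^s(\mathbb R)$, and for such $v$ let the Riesz fractional derivative $D^sv\in L^2(\mathbb R)$ be given by $\widehat{D^sv}(\xi)=(-1)^{\lfloor (s+1)/2\rfloor}|\xi|^s\,\widehat{\tilde v}(\xi)$, where $\widehat f(\xi)=\int_{\mathbb R}f(x)e^{-i\xi x}\,dx$. Put $$a(u,v)=\int_{\mathbb R}D^\alpha u\;\overline{D^\alpha v}\,dx,\qquad b(u,v)=\int_\Lambda u\,\overline v\,dx .$$ Then $\mathbb F_N\subset H^\alpha_*(\Lambda)$ for every $N\ge0$. Let $\lambda_{1,N}\le\dots\le\lambda_{N+1,N}$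 be the eigenvalues of the discrete problem: find $\lambda\in\mathbb R$ and $0\ne u\in\mathbb F_N$ such that $a(u,v)=\lambda\, b(u,v)$ for all $v\in\mathbb F_N$. Let $M=(b(\phi_j,\phi_i))_{0\le i,j\le N}$ be the mass matrix. Then all $\lambda_{i,N}$ are positive and, for fixed $\alpha$ and as $N\to\infty$, $$\lambda_{1,N}\asymp 1,\qquad \lambda_{N+1,N}\asymp N^{4\alpha},$$ where $f_N\asymp g_N$ means that $c\,g_N\le f_N\le C\,g_N$ for all large $N$ with constants $c,C>0$ independent of $N$. Further, for every $N\ge0$ the matrix $M$ is invertible, and its spectral condition number $\chi_N(M)=\|M\|_2\,\|M^{-1}\|_2$ satisfies $$\chi_N(M)=\frac{\lambda_{N+1,N}}{\lambda_{1,N}}\asymp N^{4\alpha}.$$ -/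

import Mathlib

open MeasureTheory Set Filter Asymptotics
open scoped FourierTransform ComplexConjugate

noncomputable section

/-- The classical Jacobi polynomial `P_n^{a,b}`, i.e.
`(a+1)_n / n! * ₂F₁(-n, n+a+b+1; a+1; (1-x)/2)`, written as a finite sum
(with the denominators cleared, `(c)_k` being the rising factorial). -/
def jacobiP (a b : ℝ) (n : ℕ) (x : ℝ) : ℝ :=
  ∑ k ∈ Finset.range (n + 1),
    (ascPochhammer ℝ k).eval (n + a + b + 1) * (ascPochhammer ℝ (n - k)).eval (a + k + 1)
      / ((k.factorial : ℝ) * ((n - k).factorial : ℝ)) * ((x - 1) / 2) ^ k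

/-- The generalized Jacobi function `(1 - x²)^α P_n^{α,α}(x)` on `Λ = (-1,1)`.
Functions on `Λ` are represented by their extension by zero to the real line. -/
def genJacobi (α : ℝ) (n : ℕ) : ℝ → ℂ :=
  (Ioo (-1 : ℝ) 1).indicator fun x => (((1 - x ^ 2) ^ α * jacobiP α α n x : ℝ) : ℂ)

/-- The normalized basis function `φ_n`. -/
def basisFun (α : ℝ) (n : ℕ) : ℝ → ℂ :=
  ((Real.sqrt (2 * n + 2 * α + 1) * (n.factorial : ℝ)
      / ((2 : ℝ) ^ (α + 1 / 2) * Real.Gamma (n + α + 1)) : ℝ) : ℂ) • genJacobi α n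

/-- The approximation space `F_N = span {φ_0, …, φ_N}`. -/
def approxSpace (α : ℝ) (N : ℕ) : Submodule ℂ (ℝ → ℂ) :=
  Submodule.span ℂ (range fun n : Fin (N + 1) => basisFun α n)

/-- The zero extension to `ℝ` of (the restriction to `Λ` of) a function. -/
def zeroExt (v : ℝ → ℂ) : ℝ → ℂ := (Ioo (-1 : ℝ) 1).indicator v

/-- The Fourier side of the Riesz derivative of order `s`: the function
`(-1)^⌊(s+1)/2⌋ |ω|^s 𝓕ṽ(ω)` of the angular frequency `ω = 2πξ`. (Mathlib's `𝓕 f ξ` is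
`∫ f(x) e^{-2πixξ} dx`.) -/
def rieszSymbolMul (s : ℝ) (v : ℝ → ℂ) (ξ : ℝ) : ℂ :=
  (-1 : ℂ) ^ ⌊(s + 1) / 2⌋ * ((|2 * Real.pi * ξ| ^ s : ℝ) : ℂ) * 𝓕 (zeroExt v) ξ

/-- The space `H^s_*(Λ)` (`s ≥ 0`) of those `v ∈ L²(Λ)` whose zero extension lies in `H^s(ℝ)`. -/
def HStar (s : ℝ) : Set (ℝ → ℂ) :=
  {v | MemLp v 2 (volume.restrict (Ioo (-1 : ℝ) 1)) ∧ MemLp (rieszSymbolMul s v) 2 volume}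

open Classical in
/-- The Riesz fractional derivative `D^s v ∈ L²(ℝ)` of `v ∈ H^s_*(Λ)`: the function whose
Fourier transform (in the sense of `L²`) is `rieszSymbolMul s v`. The value off `H^s_*(Λ)` is
irrelevant. -/
def rieszDeriv (s : ℝ) (v : ℝ → ℂ) : Lp ℂ 2 (volume : Measure ℝ) :=
  if h : MemLp (rieszSymbolMul s v) 2 volume then 𝓕⁻ (h.toLp (rieszSymbolMul s v)) else 0

/-- The form `a(u,v) = (D^α u, D^α v)`. -/
def formA (α : ℝ) (u v : ℝ → ℂ) : ℂ := ∫ x : ℝ, rieszDeriv α u x * conj (rieszDeriv α v x)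

/-- The form `b(u,v) = (u, v)`, the inner product of `L²(Λ)`. -/
def formB (u v : ℝ → ℂ) : ℂ := ∫ x in Ioo (-1 : ℝ) 1, u x * conj (v x)

/-- The set of discrete eigenvalues `λ_{1,N} ≤ … ≤ λ_{N+1,N}` of the Jacobi-Galerkin method. -/
def discreteEigenvalues (α : ℝ) (N : ℕ) : Set ℝ :=
  {lam | ∃ u ∈ approxSpace α N, u ≠ 0 ∧
    ∀ v ∈ approxSpace α N, formA α u v = (lam : ℂ) * formB u v}

/-- The mass matrix `M_{ij} = (φ_j, φ_i)`, `0 ≤ i, j ≤ N`. -/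
def massMatrix (α : ℝ) (N : ℕ) : Matrix (Fin (N + 1)) (Fin (N + 1)) ℂ :=
  Matrix.of fun i j => formB (basisFun α j) (basisFun α i)

/-- The spectral condition number `‖A‖₂ ‖A⁻¹‖₂` (for invertible `A`). -/
def spectralCond {n : ℕ} (A : Matrix (Fin n) (Fin n) ℂ) : ℝ :=
  ‖Matrix.toEuclideanCLM (𝕜 := ℂ) A‖ * ‖Matrix.toEuclideanCLM (𝕜 := ℂ) A⁻¹‖

end

noncomputable section

/-! Put `ν_n = n + α + 1/2`. Integrating by parts `n` times against the Rodrigues-type formula shows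
that, for `ω > 0`, the Fourier transform of `φ_n` is `(-i)^n √(2ν_n) ω^(-α-1/2) J_{ν_n}(ω)` up to a
factor depending only on `α`. Multiplication by `|ω|^α` and Plancherel turn `a(φ_m, φ_n)` into a
multiple of `∫ J_{ν_m} J_{ν_n} dt/t`, or into the integral of an odd function when `m + n` is odd.
The Bessel integrals vanish for `m ≠ n` of equal parity, and `2ν_n ∫ J_{ν_n}² dt/t` does not depend
on `n`. Hence the stiffness matrix is `κ I` with `κ = stiffConst α` (`formA_sum`), the discrete
eigenvalues are `κ/μ` with `μ` an eigenvalue of the mass matrix, and only the extreme eigenvalues of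
that matrix remain to be estimated.

The quadratic form of the mass matrix is `∫ (1-x²)^(2α) p²`, where `p` has degree at most `N` and is
expanded in the polynomials `P_n^{α,α}`, orthogonal for the smaller power `(1-x²)^α`. Above:
`(1-x²)^(2α) ≤ (1-x²)^α`, and the normalised squared norms for the weight `(1-x²)^α` are a constant
times `n!/(2α+1)_n ≤ 1` (`exists_massForm_le`). The largest eigenvalue also dominates the fixed
entry `M_00`, so it is of order 1. Below: those norms are at least of order `N^(-2α)`, and an
inverse inequality, obtained from a Hardy and a Bernstein inequality, loses another `N^(2α)` in
passing to the weight `(1-x²)^(2α)` (`exists_le_massForm`). Sharpness: for the reproducing kernel at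
the endpoint `1` of the weight `(1-x²)^(2α)` the quotient of the form by the squared coefficient
norm is `O(N^(-4α))` (`exists_massForm_le_of_kernel`). -/

/-! ### Jacobi polynomials with equal parameters: derivative and raising formulas. -/

theorem ascPochhammer_eval_succ_left (n : ℕ) (c : ℝ) :
    (ascPochhammer ℝ (n + 1)).eval c = c * (ascPochhammer ℝ n).eval (c + 1) := by
  simp [ascPochhammer_succ_left, Polynomial.eval_comp]

theorem ascPochhammer_eval_pos {c : ℝ} (hc : 0 < c) (n : ℕ) :
    0 < (ascPochhammer ℝ n).eval c := ascPochhammer_pos n c hc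

/-- The coefficients of the Gegenbauer-type Jacobi polynomial `P_n^{b,b}` in powers of
`(x - 1) / 2`. -/
def jacobiCoeff (b : ℝ) (n k : ℕ) : ℝ :=
  (ascPochhammer ℝ k).eval (n + b + b + 1) * (ascPochhammer ℝ (n - k)).eval (b + k + 1)
      / ((k.factorial : ℝ) * ((n - k).factorial : ℝ))

theorem jacobiP_eq_sum (b : ℝ) (n : ℕ) (x : ℝ) :
    jacobiP b b n x = ∑ k ∈ Finset.range (n + 1), jacobiCoeff b n k * ((x - 1) / 2) ^ k := rfl

theorem jacobiP_zero (b x : ℝ) : jacobiP b b 0 x = 1 := by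
  simp [jacobiP]

theorem jacobiP_one (b : ℝ) (n : ℕ) :
    jacobiP b b n 1 = (ascPochhammer ℝ n).eval (b + 1) / n.factorial := by
  rw [jacobiP_eq_sum, Finset.sum_range_succ']
  simp [jacobiCoeff]

/-- The rule `(P_{n+1}^{b,b})' = (n+2b+2)/2 · P_n^{b+1,b+1}`, read off coefficient by coefficient.
-/
theorem succ_mul_jacobiCoeff_succ (b : ℝ) (n j : ℕ) :
    ((j : ℝ) + 1) * jacobiCoeff b (n + 1) (j + 1)
      = (n + 2 * b + 2) * jacobiCoeff (b + 1) n j := by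
  unfold jacobiCoeff
  rw [ascPochhammer_eval_succ_left, Nat.factorial_succ, Nat.add_sub_add_right]
  have h1 : ((n + 1 : ℕ) : ℝ) + b + b + 1 = n + 2 * b + 2 := by push_cast; ring
  have h2 : (n : ℝ) + (b + 1) + (b + 1) + 1 = n + 2 * b + 2 + 1 := by ring
  have h3 : b + ((j + 1 : ℕ) : ℝ) + 1 = b + 1 + j + 1 := by push_cast; ring
  rw [h1, h2, h3]
  have := Nat.factorial_ne_zero j
  have := Nat.factorial_ne_zero (n - j)
  push_cast
  field_simp

theorem hasDerivAt_jacobiP_succ (b : ℝ) (n : ℕ) (x : ℝ) :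
    HasDerivAt (jacobiP b b (n + 1)) ((n + 2 * b + 2) / 2 * jacobiP (b + 1) (b + 1) n x) x := by
  have hy : HasDerivAt (fun x : ℝ => (x - 1) / 2) (1 / 2) x :=
    ((hasDerivAt_id x).sub_const 1).div_const 2
  have h : HasDerivAt (fun x => ∑ k ∈ Finset.range (n + 2),
      jacobiCoeff b (n + 1) k * ((x - 1) / 2) ^ k)
      (∑ k ∈ Finset.range (n + 2),
        jacobiCoeff b (n + 1) k * ((k : ℝ) * ((x - 1) / 2) ^ (k - 1) * (1 / 2))) x :=
    HasDerivAt.fun_sum fun k _ => (hy.fun_pow k).const_mul _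
  refine (h.congr_deriv ?_)
  rw [Finset.sum_range_succ', jacobiP_eq_sum, Finset.mul_sum]
  simp only [Nat.cast_zero, zero_mul, mul_zero, add_zero]
  refine Finset.sum_congr rfl fun j _ => ?_
  have := succ_mul_jacobiCoeff_succ b n j
  push_cast
  linear_combination (((x - 1) / 2) ^ j * (1 / 2)) * this

theorem differentiable_jacobiP (b : ℝ) (n : ℕ) : Differentiable ℝ (jacobiP b b n) := by
  cases n with
  | zero =>
    have : jacobiP b b 0 = fun _ => 1 := funext (jacobiP_zero b)
    rw [this]; exact differentiable_const _
  | succ n => exact fun x => (hasDerivAt_jacobiP_succ b n x).differentiableAt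

theorem continuous_jacobiP (b : ℝ) (n : ℕ) : Continuous (jacobiP b b n) :=
  (differentiable_jacobiP b n).continuous

theorem deriv_jacobiP_zero (b x : ℝ) : deriv (jacobiP b b 0) x = 0 := by
  have : jacobiP b b 0 = fun _ => 1 := funext (jacobiP_zero b)
  rw [this]; simp

theorem deriv_jacobiP_succ (b : ℝ) (n : ℕ) (x : ℝ) :
    deriv (jacobiP b b (n + 1)) x = (n + 2 * b + 2) / 2 * jacobiP (b + 1) (b + 1) n x :=
  (hasDerivAt_jacobiP_succ b n x).deriv

theorem continuous_deriv_jacobiP (b : ℝ) (n : ℕ) : Continuous (deriv (jacobiP b b n)) := by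
  cases n with
  | zero => rw [funext (deriv_jacobiP_zero b)]; exact continuous_const
  | succ n =>
    rw [funext (deriv_jacobiP_succ b n)]
    exact continuous_const.mul (continuous_jacobiP _ _)

theorem deriv_jacobiP_eq_sum (b : ℝ) (n : ℕ) (x : ℝ) :
    deriv (jacobiP b b n) x = ∑ k ∈ Finset.range (n + 1),
        jacobiCoeff b n k * ((k : ℝ) * ((x - 1) / 2) ^ (k - 1) * (1 / 2)) := by
  have hy : HasDerivAt (fun x : ℝ => (x - 1) / 2) (1 / 2) x :=
    ((hasDerivAt_id x).sub_const 1).div_const 2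
  have h : HasDerivAt (fun x => ∑ k ∈ Finset.range (n + 1),
      jacobiCoeff b n k * ((x - 1) / 2) ^ k)
      (∑ k ∈ Finset.range (n + 1),
        jacobiCoeff b n k * ((k : ℝ) * ((x - 1) / 2) ^ (k - 1) * (1 / 2))) x :=
    HasDerivAt.fun_sum fun k _ => (hy.fun_pow k).const_mul _
  exact h.deriv

/-- With `jacobiCoeff_raise_right` this is `jacobiP_raise` on coefficients: the part of the `j`-th
coefficient of `P_{k+1}^{b,b}`, `k = j + d`, that comes from the `j`-th coefficient of
`P_k^{b+1,b+1}` without a shift of degree. -/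
theorem jacobiCoeff_raise_left (b : ℝ) (hb : 0 ≤ b) (j d : ℕ) :
    (j + d + 1 : ℝ) * jacobiCoeff b (j + d + 1) j
        - (j + 2 * b + 1) * j * (jacobiCoeff b (j + d + 1) j / (j + d + 2 * b + 2))
      = (j + b + 1) * jacobiCoeff (b + 1) (j + d) j := by
  unfold jacobiCoeff
  have e1 : j + d + 1 - j = d + 1 := by omega
  have e2 : j + d - j = d := by omega
  rw [e1, e2, ascPochhammer_eval_succ_left d, Nat.factorial_succ]
  have h1 : ((j + d + 1 : ℕ) : ℝ) + b + b + 1 = j + d + 2 * b + 2 := by push_cast; ring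
  have h2 : ((j + d : ℕ) : ℝ) + (b + 1) + (b + 1) + 1 = j + d + 2 * b + 2 + 1 := by
    push_cast; ring
  have h3 : b + 1 + j + 1 = b + (j : ℝ) + 1 + 1 := by ring
  rw [h1, h2, h3]
  have hP : (ascPochhammer ℝ j).eval ((j : ℝ) + d + 2 * b + 2) * (j + d + 2 * b + 2 + j)
      = (j + d + 2 * b + 2) * (ascPochhammer ℝ j).eval ((j : ℝ) + d + 2 * b + 2 + 1) := by
    rw [← ascPochhammer_succ_eval, ascPochhammer_eval_succ_left]
  have hpos : (0 : ℝ) < j + d + 2 * b + 2 := by positivity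
  have := Nat.factorial_ne_zero j
  have := Nat.factorial_ne_zero d
  generalize (ascPochhammer ℝ j).eval ((j : ℝ) + d + 2 * b + 2) = u at *
  generalize (ascPochhammer ℝ j).eval ((j : ℝ) + d + 2 * b + 2 + 1) = v at *
  generalize (ascPochhammer ℝ d).eval (b + j + 1 + 1) = z at *
  have hv : v = u * (j + d + 2 * b + 2 + j) / (j + d + 2 * b + 2) := by
    field_simp; linarith
  rw [hv]
  push_cast
  field_simp
  ring

theorem jacobiCoeff_raise_right (b : ℝ) (hb : 0 ≤ b) (j d : ℕ) :
    (j + 1 + 2 * b + 1 : ℝ) * (j + 1) * (jacobiCoeff b (j + d + 1) (j + 1) / (j + d + 2 * b + 2))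
      = (j + 2 * b + 2) * jacobiCoeff (b + 1) (j + d) j := by
  have h := succ_mul_jacobiCoeff_succ b (j + d) j
  have hpos : (0 : ℝ) < j + d + 2 * b + 2 := by positivity
  push_cast at h
  field_simp
  linear_combination (j + 2 * b + 2) * h

/-- `(1 - x²) p' - 2 (b + 1) x p = - 2 (k + 1) P_{k+1}^{b,b}` for `p = P_k^{b+1,b+1}`. -/
theorem jacobiP_raise (b : ℝ) (hb : 0 ≤ b) (k : ℕ) (x : ℝ) :
    (1 - x ^ 2) * deriv (jacobiP (b + 1) (b + 1) k) x
        - 2 * (b + 1) * x * jacobiP (b + 1) (b + 1) k x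
      = -2 * (k + 1) * jacobiP b b (k + 1) x := by
  have hpos : (0 : ℝ) < k + 2 * b + 2 := by positivity
  obtain ⟨y, rfl⟩ : ∃ y, x = 1 + 2 * y := ⟨(x - 1) / 2, by ring⟩
  have hy : (1 + 2 * y - 1) / 2 = y := by ring
  -- In `y = (x-1)/2` one has `1 - x² = -4y(1+y)`, so the left side produces terms in `y^j` and
  -- `y^(j+1)`. Accordingly `(k+1)` times each coefficient of `P_{k+1}^{b,b}` is split as `A j + B
  -- j`; `A` vanishes at the top index and `B` at `0`, so both sums run over `k+1` terms after
  -- shifting `B`.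
  set A : ℕ → ℝ := fun j => (k + 1) * jacobiCoeff b (k + 1) j
    - (j + 2 * b + 1) * j * (jacobiCoeff b (k + 1) j / (k + 2 * b + 2)) with hA
  set B : ℕ → ℝ := fun j =>
    (j + 2 * b + 1) * j * (jacobiCoeff b (k + 1) j / (k + 2 * b + 2)) with hB
  have hAtop : A (k + 1) = 0 := by
    simp only [hA]; push_cast; field_simp; ring
  have hBzero : B 0 = 0 := by simp [hB]
  have hAj : ∀ j ∈ Finset.range (k + 1), A j = (j + b + 1) * jacobiCoeff (b + 1) k j := by
    intro j hj
    obtain ⟨d, rfl⟩ := Nat.exists_eq_add_of_le (Nat.lt_succ_iff.1 (Finset.mem_range.1 hj))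
    rw [← jacobiCoeff_raise_left b hb]
    simp only [hA]; push_cast; ring
  have hBj : ∀ j ∈ Finset.range (k + 1),
      B (j + 1) = (j + 2 * b + 2) * jacobiCoeff (b + 1) k j := by
    intro j hj
    obtain ⟨d, rfl⟩ := Nat.exists_eq_add_of_le (Nat.lt_succ_iff.1 (Finset.mem_range.1 hj))
    rw [← jacobiCoeff_raise_right b hb]
    simp only [hB]; push_cast; ring
  have hR : (k + 1) * jacobiP b b (k + 1) (1 + 2 * y)
      = ∑ j ∈ Finset.range (k + 1), ((j + b + 1) * jacobiCoeff (b + 1) k j * y ^ j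
        + (j + 2 * b + 2) * jacobiCoeff (b + 1) k j * y ^ (j + 1)) := by
    rw [jacobiP_eq_sum, hy, Finset.mul_sum]
    have : ∀ j ∈ Finset.range (k + 1 + 1), (k + 1) * (jacobiCoeff b (k + 1) j * y ^ j)
        = A j * y ^ j + B j * y ^ j := by
      intro j _; simp only [hA, hB]; ring
    rw [Finset.sum_congr rfl this, Finset.sum_add_distrib, Finset.sum_range_succ, hAtop,
      Finset.sum_range_succ' (fun j => B j * y ^ j), hBzero, zero_mul, zero_mul, add_zero,
      add_zero, ← Finset.sum_add_distrib]
    exact Finset.sum_congr rfl fun j hj => by rw [hAj j hj, hBj j hj]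
  have hL : (1 - (1 + 2 * y) ^ 2) * deriv (jacobiP (b + 1) (b + 1) k) (1 + 2 * y)
        - 2 * (b + 1) * (1 + 2 * y) * jacobiP (b + 1) (b + 1) k (1 + 2 * y)
      = -2 * ∑ j ∈ Finset.range (k + 1), ((j + b + 1) * jacobiCoeff (b + 1) k j * y ^ j
        + (j + 2 * b + 2) * jacobiCoeff (b + 1) k j * y ^ (j + 1)) := by
    rw [deriv_jacobiP_eq_sum, jacobiP_eq_sum, hy, Finset.mul_sum, Finset.mul_sum, Finset.mul_sum,
      ← Finset.sum_sub_distrib]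
    refine Finset.sum_congr rfl fun j _ => ?_
    cases j with
    | zero => simp; ring
    | succ j => simp only [Nat.add_sub_cancel]; push_cast; ring
  rw [hL, ← hR]; ring

/-! ### The weight, orthogonality and norms. -/

/-- The weight `(1 - x²)^g`. -/
def wt (g x : ℝ) : ℝ := (1 - x ^ 2) ^ g

theorem continuous_wt {g : ℝ} (hg : 0 ≤ g) : Continuous (wt g) :=
  (continuous_const.sub (continuous_id.pow 2)).rpow_const fun _ => Or.inr hg

theorem wt_nonneg (g : ℝ) {x : ℝ} (hx : x ∈ Icc (-1 : ℝ) 1) : 0 ≤ wt g x :=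
  Real.rpow_nonneg (by nlinarith [hx.1, hx.2]) _

theorem wt_pos (g : ℝ) {x : ℝ} (hx : x ∈ Ioo (-1 : ℝ) 1) : 0 < wt g x :=
  Real.rpow_pos_of_pos (by nlinarith [hx.1, hx.2]) _

theorem wt_succ {g : ℝ} (hg : 0 ≤ g) (x : ℝ) : wt (g + 1) x = (1 - x ^ 2) * wt g x := by
  unfold wt
  by_cases h : 1 - x ^ 2 = 0
  · rw [h, Real.zero_rpow (by linarith), zero_mul]
  · rw [Real.rpow_add_one h, mul_comm]

theorem wt_apply_one {g : ℝ} (hg : 0 < g) : wt g 1 = 0 := by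
  simp [wt, Real.zero_rpow hg.ne']

theorem wt_apply_neg_one {g : ℝ} (hg : 0 < g) : wt g (-1) = 0 := by
  simp [wt, Real.zero_rpow hg.ne']

theorem hasDerivAt_wt_succ {g : ℝ} (hg : 0 ≤ g) (x : ℝ) :
    HasDerivAt (wt (g + 1)) (-2 * (g + 1) * x * wt g x) x := by
  have h : HasDerivAt (fun x : ℝ => 1 - x ^ 2) (-(2 * x)) x := by
    simpa using ((hasDerivAt_id x).pow 2).const_sub 1
  have := h.rpow_const (p := g + 1) (Or.inr (by linarith))
  refine this.congr_deriv ?_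
  rw [add_sub_cancel_right, wt]; ring

/-- One step of Rodrigues' formula; every later integration by parts against a Jacobi polynomial
rests on it. -/
theorem hasDerivAt_wt_mul_jacobiP (b : ℝ) (hb : 0 ≤ b) (k : ℕ) (x : ℝ) :
    HasDerivAt (fun x => wt (b + 1) x * jacobiP (b + 1) (b + 1) k x)
      (-2 * (k + 1) * (wt b x * jacobiP b b (k + 1) x)) x := by
  refine ((hasDerivAt_wt_succ hb x).mul
    ((differentiable_jacobiP (b + 1) k) x).hasDerivAt).congr_deriv ?_
  rw [wt_succ hb]
  linear_combination (wt b x) * jacobiP_raise b hb k x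

/-- The weighted inner product of two Jacobi polynomials. -/
def jacobiInner (b : ℝ) (m n : ℕ) : ℝ :=
  ∫ x in (-1 : ℝ)..1, wt b x * (jacobiP b b m x * jacobiP b b n x)

/-- The mass `∫ (1 - x²)^g` of the weight. -/
def wtMass (g : ℝ) : ℝ := ∫ x in (-1 : ℝ)..1, wt g x

theorem wtMass_pos {g : ℝ} (hg : 0 ≤ g) : 0 < wtMass g :=
  intervalIntegral.intervalIntegral_pos_of_pos_on
    ((continuous_wt hg).intervalIntegrable _ _) (fun _ hx => wt_pos g hx) (by norm_num)

theorem integral_wt_mul_jacobiP_succ (b : ℝ) (hb : 0 ≤ b) (k : ℕ) (f f' : ℝ → ℝ)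
    (hf : ∀ x, HasDerivAt f (f' x) x) (hf' : Continuous f') :
    ∫ x in (-1 : ℝ)..1, f x * (wt b x * jacobiP b b (k + 1) x)
      = 1 / (2 * (k + 1)) *
        ∫ x in (-1 : ℝ)..1, f' x * (wt (b + 1) x * jacobiP (b + 1) (b + 1) k x) := by
  have h := intervalIntegral.integral_mul_deriv_eq_deriv_mul (a := (-1 : ℝ)) (b := 1)
    (fun x _ => hf x) (fun x _ => hasDerivAt_wt_mul_jacobiP b hb k x)
    (hf'.intervalIntegrable _ _) ((continuous_const.mul
      ((continuous_wt hb).mul (continuous_jacobiP b (k + 1)))).intervalIntegrable _ _)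
  rw [wt_apply_one (by linarith), wt_apply_neg_one (by linarith)] at h
  have e : ∀ x : ℝ, f x * (-2 * (k + 1) * (wt b x * jacobiP b b (k + 1) x))
      = (-2 * (k + 1)) * (f x * (wt b x * jacobiP b b (k + 1) x)) := fun x => by ring
  simp only [e, intervalIntegral.integral_const_mul, zero_mul, mul_zero, zero_sub,
    sub_zero] at h
  have : (0 : ℝ) < k + 1 := by positivity
  rw [div_mul_eq_mul_div, eq_div_iff (by positivity)]
  linarith

theorem jacobiInner_comm (b : ℝ) (m n : ℕ) : jacobiInner b m n = jacobiInner b n m := by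
  unfold jacobiInner; simp only [mul_comm (jacobiP b b m _)]

/-- One integration by parts lowers both degrees and raises the parameter. Orthogonality and the
norms follow by induction on the degree with `b` varying. -/
theorem jacobiInner_succ_succ (b : ℝ) (hb : 0 ≤ b) (m n : ℕ) :
    jacobiInner b (m + 1) (n + 1)
      = (m + 2 * b + 2) / (4 * (n + 1)) * jacobiInner (b + 1) m n := by
  have h := integral_wt_mul_jacobiP_succ b hb n (jacobiP b b (m + 1)) _
    (hasDerivAt_jacobiP_succ b m) (continuous_const.mul (continuous_jacobiP _ _))
  unfold jacobiInner
  have e1 : ∀ x : ℝ, wt b x * (jacobiP b b (m + 1) x * jacobiP b b (n + 1) x)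
    = jacobiP b b (m + 1) x * (wt b x * jacobiP b b (n + 1) x) := fun x => by ring
  have e2 : ∀ x : ℝ, (m + 2 * b + 2) / 2 * jacobiP (b + 1) (b + 1) m x *
      (wt (b + 1) x * jacobiP (b + 1) (b + 1) n x)
    = (m + 2 * b + 2) / 2 *
      (wt (b + 1) x * (jacobiP (b + 1) (b + 1) m x * jacobiP (b + 1) (b + 1) n x)) :=
    fun x => by ring
  simp only [e1, h, e2, intervalIntegral.integral_const_mul]
  have : (0 : ℝ) < n + 1 := by positivity
  field_simp
  ring

theorem jacobiInner_zero_succ (b : ℝ) (hb : 0 ≤ b) (n : ℕ) : jacobiInner b 0 (n + 1) = 0 := by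
  have h := integral_wt_mul_jacobiP_succ b hb n (fun _ => 1) (fun _ => 0)
    (fun x => hasDerivAt_const x 1) continuous_const
  unfold jacobiInner
  simpa [jacobiP_zero] using h

theorem jacobiInner_zero_zero (b : ℝ) : jacobiInner b 0 0 = wtMass b := by
  simp [jacobiInner, wtMass, jacobiP_zero]

theorem jacobiInner_of_ne (b : ℝ) (hb : 0 ≤ b) {m n : ℕ} (hmn : m ≠ n) :
    jacobiInner b m n = 0 := by
  induction m generalizing n b with
  | zero =>
    obtain ⟨n, rfl⟩ := Nat.exists_eq_succ_of_ne_zero hmn.symm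
    exact jacobiInner_zero_succ b hb n
  | succ m ih =>
    cases n with
    | zero => rw [jacobiInner_comm]; exact jacobiInner_zero_succ b hb m
    | succ n =>
      rw [jacobiInner_succ_succ b hb, ih (b + 1) (by linarith) (by omega), mul_zero]

/-- Integrate the derivative of `x (1-x²)^(g+1)`, which vanishes at both endpoints. -/
theorem wtMass_succ {g : ℝ} (hg : 0 ≤ g) :
    (2 * g + 3) * wtMass (g + 1) = (2 * g + 2) * wtMass g := by
  have hd : ∀ x, HasDerivAt (fun x => x * wt (g + 1) x)
      ((2 * g + 3) * wt (g + 1) x - (2 * g + 2) * wt g x) x := fun x => by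
    refine ((hasDerivAt_id x).mul (hasDerivAt_wt_succ hg x)).congr_deriv ?_
    rw [wt_succ hg, id]; ring
  have c1 : Continuous (wt (g + 1)) := continuous_wt (by linarith)
  have c0 := continuous_wt hg
  have h := intervalIntegral.integral_eq_sub_of_hasDerivAt (a := (-1 : ℝ)) (b := 1)
    (fun x _ => hd x) (((c1.const_mul _).sub (c0.const_mul _)).intervalIntegrable _ _)
  rw [intervalIntegral.integral_sub ((c1.const_mul _).intervalIntegrable _ _)
    ((c0.const_mul _).intervalIntegrable _ _), intervalIntegral.integral_const_mul,
    intervalIntegral.integral_const_mul, wt_apply_one (by linarith),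
    wt_apply_neg_one (by linarith)] at h
  simp only [wtMass]; linarith

theorem jacobiInner_self (b : ℝ) (hb : 0 ≤ b) (n : ℕ) :
    jacobiInner b n n = wtMass b * (2 * b + 1) * (ascPochhammer ℝ n).eval (b + 1) ^ 2
      / ((2 * n + 2 * b + 1) * n.factorial * (ascPochhammer ℝ n).eval (2 * b + 1)) := by
  induction n generalizing b with
  | zero =>
    simp [jacobiInner_zero_zero]
    have : 2 * b + 1 ≠ 0 := by linarith
    field_simp
  | succ n ih =>
    rw [jacobiInner_succ_succ b hb, ih (b + 1) (by linarith)]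
    have hM : wtMass (b + 1) = (2 * b + 2) * wtMass b / (2 * b + 3) := by
      have := wtMass_succ hb
      field_simp
      linarith
    rw [hM, ascPochhammer_eval_succ_left n (b + 1), ascPochhammer_eval_succ_left n (2 * b + 1)]
    have h2 : 2 * (b + 1) + 1 = 2 * b + 1 + 1 + 1 := by ring
    have h3 : (2 * b + 1 + 1) * (ascPochhammer ℝ n).eval (2 * b + 1 + 1 + 1)
        = (ascPochhammer ℝ n).eval (2 * b + 1 + 1) * (2 * b + 1 + 1 + n) := by
      rw [← ascPochhammer_succ_eval, ascPochhammer_eval_succ_left]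
    rw [h2]
    have hp := ascPochhammer_eval_pos (show 0 < 2 * b + 1 + 1 by linarith) n
    have hq := ascPochhammer_eval_pos (show 0 < 2 * b + 1 + 1 + 1 by linarith) n
    generalize (ascPochhammer ℝ n).eval (2 * b + 1 + 1 + 1) = v at *
    generalize (ascPochhammer ℝ n).eval (2 * b + 1 + 1) = u at *
    have hu : u = (2 * b + 1 + 1) * v / (2 * b + 1 + 1 + n) := by
      field_simp; linarith
    rw [hu, Nat.factorial_succ]
    push_cast
    have := Nat.factorial_ne_zero n
    have h4 : (0 : ℝ) < 2 * (n + 1) + 2 * b + 1 := by positivity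
    have h5 : (0 : ℝ) < 2 * n + 2 * (b + 1) + 1 := by positivity
    have h6 : (0 : ℝ) < 2 * b + 1 + 1 + n := by positivity
    have h7 : (0 : ℝ) < 2 * b + 1 + 1 := by positivity
    field_simp
    ring

theorem jacobiInner_self_pos (b : ℝ) (hb : 0 ≤ b) (n : ℕ) : 0 < jacobiInner b n n := by
  rw [jacobiInner_self b hb]
  have := wtMass_pos hb
  have := ascPochhammer_eval_pos (show 0 < b + 1 by linarith) n
  have := ascPochhammer_eval_pos (show 0 < 2 * b + 1 by linarith) n
  positivity

theorem exists_bounds_of_tendsto_pos {f : ℕ → ℝ} {l : ℝ} (hf : ∀ n, 0 < f n) (hl : 0 < l)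
    (h : Tendsto f atTop (nhds l)) : ∃ c C : ℝ, 0 < c ∧ 0 < C ∧ ∀ n, c ≤ f n ∧ f n ≤ C := by
  obtain ⟨C, hC⟩ := h.bddAbove_range
  obtain ⟨D, hD⟩ := (h.inv₀ hl.ne').bddAbove_range
  have hC' : ∀ n, f n ≤ C := fun n => hC ⟨n, rfl⟩
  have hD' : ∀ n, (f n)⁻¹ ≤ D := fun n => hD ⟨n, rfl⟩
  have hCpos : 0 < C := (hf 0).trans_le (hC' 0)
  have hDpos : 0 < D := (inv_pos.2 (hf 0)).trans_le (hD' 0)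
  exact ⟨D⁻¹, C, inv_pos.2 hDpos, hCpos, fun n => ⟨inv_le_of_inv_le₀ (hf n) (hD' n), hC' n⟩⟩

/-- `(s+1)_n / n!` grows like `n ^ s`. -/
theorem exists_bounds_ascPochhammer_div_factorial {s : ℝ} (hs : 0 < s) :
    ∃ c C : ℝ, 0 < c ∧ 0 < C ∧ ∀ n : ℕ,
      c * ((n : ℝ) + 1) ^ s ≤ (ascPochhammer ℝ n).eval (s + 1) / n.factorial ∧
      (ascPochhammer ℝ n).eval (s + 1) / n.factorial ≤ C * ((n : ℝ) + 1) ^ s := by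
  have hp : ∀ n, 0 < (ascPochhammer ℝ n).eval (s + 1) :=
    fun n => ascPochhammer_eval_pos (by linarith) n
  have h0 : ∀ n : ℕ, (0 : ℝ) < ((n : ℝ) + 1) ^ s := fun n => by positivity
  -- Euler's limit `n^s n! / (s(s+1)⋯(s+n)) → Γ(s)`. The factor `(n/(n+1))^s` replaces `n^s` by
  -- `(n+1)^s`, which is positive at `n = 0` too, so the bounds hold for every `n`.
  have key : Tendsto (fun n : ℕ => (ascPochhammer ℝ n).eval (s + 1) / n.factorial
      / ((n : ℝ) + 1) ^ s) atTop (nhds (1 ^ s / (s * Real.Gamma s))) := by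
    have h1 : Tendsto (fun n : ℕ => ((n : ℝ) / (n + 1)) ^ s) atTop (nhds (1 ^ s)) :=
      (tendsto_natCast_div_add_atTop (1 : ℝ)).rpow_const (Or.inl one_ne_zero)
    have h2 := (Real.GammaSeq_tendsto_Gamma s).const_mul s
    refine (h1.div h2 (mul_pos hs (Real.Gamma_pos_of_pos hs)).ne').congr' ?_
    filter_upwards [eventually_ge_atTop 1] with n hn
    have hn' : (0 : ℝ) < n := by exact_mod_cast hn
    have hprod : ∏ j ∈ Finset.range (n + 1), (s + (j : ℝ))
        = s * (ascPochhammer ℝ n).eval (s + 1) := by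
      rw [← ascPochhammer_eval_succ_left]
      induction n + 1 with
      | zero => simp
      | succ m ih => rw [Finset.prod_range_succ, ih, ascPochhammer_succ_eval]
    simp only [Pi.div_apply]
    rw [Real.GammaSeq, hprod, Real.div_rpow hn'.le (by positivity)]
    have := hp n
    have := h0 n
    have := Real.rpow_pos_of_pos hn' s
    have := Nat.factorial_ne_zero n
    field_simp
  obtain ⟨c, C, hc, hC, h⟩ := exists_bounds_of_tendsto_pos
    (fun n => by have := hp n; have := h0 n; positivity)
    (by have := Real.Gamma_pos_of_pos hs; positivity) key
  exact ⟨c, C, hc, hC, fun n => ⟨(le_div_iff₀ (h0 n)).1 (h n).1, (div_le_iff₀ (h0 n)).1 (h n).2⟩⟩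

/-! ### Weighted Bernstein, Hardy and inverse inequalities for polynomials. -/

/-- A finite Jacobi expansion. -/
def jacobiComb (b : ℝ) (N : ℕ) (a : ℕ → ℝ) (x : ℝ) : ℝ :=
  ∑ n ∈ Finset.range (N + 1), a n * jacobiP b b n x

theorem hasDerivAt_jacobiComb (b : ℝ) (N : ℕ) (a : ℕ → ℝ) (x : ℝ) :
    HasDerivAt (jacobiComb b N a)
      (∑ n ∈ Finset.range (N + 1), a n * deriv (jacobiP b b n) x) x :=
  HasDerivAt.fun_sum fun n _ => ((differentiable_jacobiP b n x).hasDerivAt).const_mul _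

theorem continuous_jacobiComb (b : ℝ) (N : ℕ) (a : ℕ → ℝ) : Continuous (jacobiComb b N a) :=
  continuous_finsetSum _ fun n _ => continuous_const.mul (continuous_jacobiP b n)

theorem continuous_deriv_jacobiComb (b : ℝ) (N : ℕ) (a : ℕ → ℝ) :
    Continuous fun x => ∑ n ∈ Finset.range (N + 1), a n * deriv (jacobiP b b n) x :=
  continuous_finsetSum _ fun n _ => continuous_const.mul (continuous_deriv_jacobiP b n)

theorem integral_wt_mul_sq_sum (g : ℝ) (hg : 0 ≤ g) (N : ℕ) (a : ℕ → ℝ) (f : ℕ → ℝ → ℝ)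
    (hf : ∀ n, Continuous (f n))
    (horth : ∀ m n, m ≠ n → ∫ x in (-1 : ℝ)..1, wt g x * (f m x * f n x) = 0) :
    ∫ x in (-1 : ℝ)..1, wt g x * (∑ n ∈ Finset.range (N + 1), a n * f n x) ^ 2
      = ∑ n ∈ Finset.range (N + 1), a n ^ 2 * ∫ x in (-1 : ℝ)..1, wt g x * (f n x * f n x) := by
  have hc : ∀ m n, Continuous fun x => a m * a n * (wt g x * (f m x * f n x)) := fun m n =>
    continuous_const.mul ((continuous_wt hg).mul ((hf m).mul (hf n)))
  have e : ∀ x, wt g x * (∑ n ∈ Finset.range (N + 1), a n * f n x) ^ 2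
      = ∑ m ∈ Finset.range (N + 1), ∑ n ∈ Finset.range (N + 1),
        a m * a n * (wt g x * (f m x * f n x)) := by
    intro x
    rw [sq, Finset.sum_mul_sum, Finset.mul_sum]
    refine Finset.sum_congr rfl fun m _ => ?_
    rw [Finset.mul_sum]
    exact Finset.sum_congr rfl fun n _ => by ring
  simp only [e]
  rw [intervalIntegral.integral_finsetSum fun m _ =>
    (continuous_finsetSum _ fun n _ => hc m n).intervalIntegrable _ _]
  refine Finset.sum_congr rfl fun m hm => ?_
  rw [intervalIntegral.integral_finsetSum fun n _ => (hc m n).intervalIntegrable _ _,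
    Finset.sum_eq_single m]
  · rw [intervalIntegral.integral_const_mul, sq]
  · intro n _ hn
    rw [intervalIntegral.integral_const_mul, horth m n hn.symm, mul_zero]
  · exact fun h => absurd hm h

theorem integral_wt_mul_jacobiComb_sq (b : ℝ) (hb : 0 ≤ b) (N : ℕ) (a : ℕ → ℝ) :
    ∫ x in (-1 : ℝ)..1, wt b x * jacobiComb b N a x ^ 2
      = ∑ n ∈ Finset.range (N + 1), a n ^ 2 * jacobiInner b n n :=
  integral_wt_mul_sq_sum b hb N a _ (continuous_jacobiP b) fun _ _ h => jacobiInner_of_ne b hb h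

/-- The derivatives are again Jacobi polynomials, orthogonal for the raised weight. The factor on
the diagonal is the Sturm–Liouville eigenvalue; off it the right side is zero, so its asymmetry in
`m`, `n` is harmless. -/
theorem integral_wt_succ_mul_deriv_jacobiP (b : ℝ) (hb : 0 ≤ b) (m n : ℕ) :
    ∫ x in (-1 : ℝ)..1, wt (b + 1) x * (deriv (jacobiP b b m) x * deriv (jacobiP b b n) x)
      = m * (n + 2 * b + 1) * jacobiInner b m n := by
  cases m with
  | zero => simp [deriv_jacobiP_zero]
  | succ m =>
    cases n with
    | zero => simp [deriv_jacobiP_zero, jacobiInner_of_ne b hb (Nat.succ_ne_zero m)]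
    | succ n =>
      rw [jacobiInner_comm, jacobiInner_succ_succ b hb, jacobiInner_comm]
      have e : ∀ x : ℝ, wt (b + 1) x *
          (deriv (jacobiP b b (m + 1)) x * deriv (jacobiP b b (n + 1)) x)
          = (m + 2 * b + 2) / 2 * ((n + 2 * b + 2) / 2) * (wt (b + 1) x *
            (jacobiP (b + 1) (b + 1) m x * jacobiP (b + 1) (b + 1) n x)) := fun x => by
        rw [deriv_jacobiP_succ, deriv_jacobiP_succ]; ring
      simp only [e, intervalIntegral.integral_const_mul]
      by_cases h : m = n
      · subst h
        rw [jacobiInner]; push_cast; field_simp; ring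
      · have := jacobiInner_of_ne (b + 1) (by linarith) h
        rw [this]; rw [jacobiInner] at this; rw [this]; ring

/-- Bernstein's inequality in `L²`: by Parseval the constant is the largest Sturm–Liouville
eigenvalue in degree at most `N`. -/
theorem integral_wt_succ_mul_deriv_sq_le (b : ℝ) (hb : 0 ≤ b) (N : ℕ) (a : ℕ → ℝ) :
    ∫ x in (-1 : ℝ)..1, wt (b + 1) x *
        (∑ n ∈ Finset.range (N + 1), a n * deriv (jacobiP b b n) x) ^ 2
      ≤ N * (N + 2 * b + 1) * ∫ x in (-1 : ℝ)..1, wt b x * jacobiComb b N a x ^ 2 := by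
  rw [integral_wt_mul_jacobiComb_sq b hb, integral_wt_mul_sq_sum (b + 1) (by linarith) N a _
    (continuous_deriv_jacobiP b) fun m n h => by
      rw [integral_wt_succ_mul_deriv_jacobiP b hb, jacobiInner_of_ne b hb h, mul_zero],
    Finset.mul_sum]
  refine Finset.sum_le_sum fun n hn => ?_
  have hnN : (n : ℝ) ≤ N := by exact_mod_cast Nat.lt_succ_iff.1 (Finset.mem_range.1 hn)
  rw [integral_wt_succ_mul_deriv_jacobiP b hb]
  have h0 : 0 ≤ a n ^ 2 * jacobiInner b n n :=
    mul_nonneg (sq_nonneg _) (jacobiInner_self_pos b hb n).le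
  have h1 : (n : ℝ) * (n + 2 * b + 1) ≤ N * (N + 2 * b + 1) := by gcongr
  calc _ = n * (n + 2 * b + 1) * (a n ^ 2 * jacobiInner b n n) := by ring
    _ ≤ _ := mul_le_mul_of_nonneg_right h1 h0

/-- Near `1` the weight is `(1-x)^g` times a continuous function; reflection gives the other half.
Negative `g` occurs as the exponent `g - 1` in the Hardy inequality. -/
theorem intervalIntegrable_wt {g : ℝ} (hg : -1 < g) :
    IntervalIntegrable (wt g) volume (-1) 1 := by
  have h1 : IntervalIntegrable (wt g) volume 0 1 := by
    have h := (intervalIntegral.intervalIntegrable_rpow' (a := 1) (b := 0) hg).comp_sub_left 1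
    rw [sub_self, sub_zero] at h
    have hc : ContinuousOn (fun x : ℝ => (1 + x) ^ g) (uIcc 0 1) := by
      refine ContinuousOn.rpow_const (by fun_prop) fun x hx => Or.inl ?_
      rw [uIcc_of_le zero_le_one] at hx
      linarith [hx.1]
    refine (h.mul_continuousOn hc).congr fun x hx => ?_
    rw [uIoc_of_le zero_le_one] at hx
    simp only [wt]
    rw [← Real.mul_rpow (by linarith [hx.2]) (by linarith [hx.1])]
    congr 1; ring
  have h2 : IntervalIntegrable (wt g) volume (-1) 0 := by
    have h := h1.comp_sub_left 0
    rw [sub_zero, zero_sub] at h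
    refine h.symm.congr fun x _ => ?_
    simp [wt]
  exact h2.trans h1

theorem wt_succ_of_mem (g : ℝ) {x : ℝ} (hx : x ∈ Ioo (-1 : ℝ) 1) :
    wt (g + 1) x = (1 - x ^ 2) * wt g x := by
  have h : 0 < 1 - x ^ 2 := by nlinarith [hx.1, hx.2]
  unfold wt
  rw [Real.rpow_add_one h.ne', mul_comm]

theorem hasDerivAt_wt_of_mem (g : ℝ) {x : ℝ} (hx : x ∈ Ioo (-1 : ℝ) 1) :
    HasDerivAt (wt g) (-2 * g * x * wt (g - 1) x) x := by
  have h0 : 0 < 1 - x ^ 2 := by nlinarith [hx.1, hx.2]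
  have h : HasDerivAt (fun x : ℝ => 1 - x ^ 2) (-(2 * x)) x := by
    simpa using ((hasDerivAt_id x).pow 2).const_sub 1
  refine (h.rpow_const (p := g) (Or.inl h0.ne')).congr_deriv ?_
  rw [wt]; ring

/-- A Hardy-type inequality on `(-1, 1)`. -/
theorem integral_wt_pred_mul_sq_le {g : ℝ} (hg : 0 < g) {p p' : ℝ → ℝ}
    (hp : ∀ x, HasDerivAt p (p' x) x) (hp' : Continuous p') :
    g * ∫ x in (-1 : ℝ)..1, wt (g - 1) x * p x ^ 2
      ≤ (1 + 2 * g) * (∫ x in (-1 : ℝ)..1, wt g x * p x ^ 2)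
        + 1 / g * ∫ x in (-1 : ℝ)..1, wt (g + 1) x * p' x ^ 2 := by
  have hpc : Continuous p := continuous_iff_continuousAt.2 fun x => (hp x).continuousAt
  have iA : IntervalIntegrable (fun x => wt (g - 1) x * p x ^ 2) volume (-1) 1 :=
    (intervalIntegrable_wt (by linarith)).mul_continuousOn (hpc.pow 2).continuousOn
  have iB : IntervalIntegrable (fun x => wt g x * p x ^ 2) volume (-1) 1 :=
    ((continuous_wt hg.le).mul (hpc.pow 2)).intervalIntegrable _ _
  have iD : IntervalIntegrable (fun x => wt (g + 1) x * p' x ^ 2) volume (-1) 1 :=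
    ((continuous_wt (by linarith)).mul (hp'.pow 2)).intervalIntegrable _ _
  have iE : IntervalIntegrable (fun x => wt g x * (2 * x * p x * p' x)) volume (-1) 1 :=
    ((continuous_wt hg.le).mul (by fun_prop)).intervalIntegrable _ _
  -- The integral of this derivative is zero. Writing `x² = 1 - (1 - x²)` isolates `2g ∫
  -- (1-x²)^(g-1) p²`, and half of it absorbs the cross term `2xpp'`.
  have hd : ∀ x ∈ Ioo (-1 : ℝ) 1, HasDerivAt (fun x => x * wt g x * p x ^ 2)
      ((1 + 2 * g) * (wt g x * p x ^ 2) - 2 * g * (wt (g - 1) x * p x ^ 2)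
        + wt g x * (2 * x * p x * p' x)) x := by
    intro x hx
    refine (((hasDerivAt_id x).mul (hasDerivAt_wt_of_mem g hx)).mul
      ((hp x).pow 2)).congr_deriv ?_
    have h := wt_succ_of_mem (g - 1) hx
    rw [sub_add_cancel] at h
    simp only [id, Pi.mul_apply, Pi.pow_apply]
    rw [h]; push_cast; ring
  have hF := intervalIntegral.integral_eq_sub_of_hasDerivAt_of_le (by norm_num)
    (((continuous_id.mul (continuous_wt hg.le)).mul (hpc.pow 2)).continuousOn) hd
    (((iB.const_mul _).sub (iA.const_mul _)).add iE)
  rw [intervalIntegral.integral_add ((iB.const_mul _).sub (iA.const_mul _)) iE,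
    intervalIntegral.integral_sub (iB.const_mul _) (iA.const_mul _),
    intervalIntegral.integral_const_mul, intervalIntegral.integral_const_mul] at hF
  simp only [id, wt_apply_one hg, wt_apply_neg_one hg, mul_zero, zero_mul, Pi.mul_apply,
    Pi.pow_apply, sub_zero] at hF
  have hle : ∫ x in (-1 : ℝ)..1, wt g x * (2 * x * p x * p' x)
      ≤ ∫ x in (-1 : ℝ)..1, (g * (wt (g - 1) x * p x ^ 2)
        + 1 / g * (wt (g + 1) x * p' x ^ 2)) := by
    refine intervalIntegral.integral_mono_on_of_le_Ioo (by norm_num) iE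
      ((iA.const_mul _).add (iD.const_mul _)) fun x hx => ?_
    have h := wt_succ_of_mem (g - 1) hx
    rw [sub_add_cancel] at h
    have h1 := wt_succ_of_mem g hx
    have hw := wt_pos (g - 1) hx
    have hx1 : 0 < 1 - x ^ 2 := by nlinarith [hx.1, hx.2]
    rw [h1, h]
    -- Weighted AM–GM as a completed square; the second summand is what remains on replacing `x²` by
    -- `1`.
    have e : g * (wt (g - 1) x * p x ^ 2)
        + 1 / g * ((1 - x ^ 2) * ((1 - x ^ 2) * wt (g - 1) x) * p' x ^ 2)
        - (1 - x ^ 2) * wt (g - 1) x * (2 * x * p x * p' x)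
        = wt (g - 1) x / g * ((g * p x - x * (1 - x ^ 2) * p' x) ^ 2
          + (1 - x ^ 2) ^ 2 * (1 - x ^ 2) * p' x ^ 2) := by
      field_simp; ring
    have : 0 ≤ wt (g - 1) x / g * ((g * p x - x * (1 - x ^ 2) * p' x) ^ 2
          + (1 - x ^ 2) ^ 2 * (1 - x ^ 2) * p' x ^ 2) := by positivity
    linarith
  rw [intervalIntegral.integral_add (iA.const_mul _) (iD.const_mul _),
    intervalIntegral.integral_const_mul, intervalIntegral.integral_const_mul] at hle
  linarith

/-- Split at `1 - x² = 1/R`: inside, `(R(1-x²))^g ≥ 1`; in the boundary layer one factor `1 - x²` is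
below `1/R`. -/
theorem wt_le_rpow_mul_add {g R : ℝ} (hg : 0 ≤ g) (hR : 0 < R) {x : ℝ} (hx : x ∈ Ioo (-1 : ℝ) 1) :
    wt g x ≤ R ^ g * wt (2 * g) x + R⁻¹ * wt (g - 1) x := by
  have h0 : 0 < 1 - x ^ 2 := by nlinarith [hx.1, hx.2]
  have hw1 := wt_pos (2 * g) hx
  have hw2 := wt_pos (g - 1) hx
  have hw := wt_pos g hx
  by_cases h : 1 ≤ R * (1 - x ^ 2)
  · have h1 : 1 ≤ R ^ g * wt g x := by
      rw [wt, ← Real.mul_rpow hR.le h0.le]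
      exact Real.one_le_rpow h hg
    have h2 : wt (2 * g) x = wt g x * wt g x := by
      rw [two_mul, wt, wt, Real.rpow_add h0]
    have h3 : wt g x ≤ R ^ g * wt (2 * g) x := by
      rw [h2]; nlinarith
    have : 0 < R⁻¹ * wt (g - 1) x := by positivity
    linarith
  · have e := wt_succ_of_mem (g - 1) hx
    rw [sub_add_cancel] at e
    have h1 : 1 - x ^ 2 ≤ R⁻¹ := by
      rw [← one_div, le_div_iff₀ hR]; linarith [not_le.1 h]
    have : wt g x ≤ R⁻¹ * wt (g - 1) x := by
      rw [e]; exact mul_le_mul_of_nonneg_right h1 hw2.le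
    have : 0 < R ^ g * wt (2 * g) x := by positivity
    linarith

/-- A weighted inverse inequality for polynomials of degree at most `N`. -/
theorem exists_integral_wt_le_integral_wt_two_mul {g : ℝ} (hg : 0 < g) :
    ∃ C : ℝ, 0 < C ∧ ∀ (N : ℕ) (a : ℕ → ℝ),
      ∫ x in (-1 : ℝ)..1, wt g x * jacobiComb g N a x ^ 2
        ≤ C * ((N : ℝ) + 1) ^ (2 * g) *
          ∫ x in (-1 : ℝ)..1, wt (2 * g) x * jacobiComb g N a x ^ 2 := by
  -- The constant of Hardy combined with Bernstein: `∫ w^(g-1) p² ≤ K (N+1)² ∫ w^g p²` with `w = 1 -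
  -- x²`, using `N(N+2g+1) ≤ (2g+1)(N+1)²`.
  set K : ℝ := ((1 + 2 * g) + 1 / g * (2 * g + 1)) / g with hK
  have hKpos : 0 < K := by positivity
  refine ⟨2 * (2 * K) ^ g, by positivity, fun N a => ?_⟩
  have hpc := continuous_jacobiComb g N a
  set A := ∫ x in (-1 : ℝ)..1, wt (g - 1) x * jacobiComb g N a x ^ 2 with hA
  set B := ∫ x in (-1 : ℝ)..1, wt g x * jacobiComb g N a x ^ 2 with hB
  set I := ∫ x in (-1 : ℝ)..1, wt (2 * g) x * jacobiComb g N a x ^ 2 with hI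
  have h1 := integral_wt_pred_mul_sq_le hg (hasDerivAt_jacobiComb g N a)
    (continuous_deriv_jacobiComb g N a)
  have h2 := integral_wt_succ_mul_deriv_sq_le g hg.le N a
  rw [← hA, ← hB] at h1
  rw [← hB] at h2
  have hB0 : 0 ≤ B := intervalIntegral.integral_nonneg (by norm_num)
    fun x hx => mul_nonneg (wt_nonneg _ hx) (sq_nonneg _)
  have hN : (0 : ℝ) ≤ N := Nat.cast_nonneg N
  have hAB : A ≤ K * ((N : ℝ) + 1) ^ 2 * B := by
    have h3 : (N : ℝ) * (N + 2 * g + 1) ≤ (2 * g + 1) * ((N : ℝ) + 1) ^ 2 := by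
      nlinarith [mul_nonneg hg.le hN, mul_nonneg hg.le (sq_nonneg (N : ℝ))]
    have h4 : (1 : ℝ) ≤ ((N : ℝ) + 1) ^ 2 := by nlinarith
    have h5 : g * A ≤ ((1 + 2 * g) * ((N : ℝ) + 1) ^ 2
        + 1 / g * ((2 * g + 1) * ((N : ℝ) + 1) ^ 2)) * B := by
      refine h1.trans ?_
      rw [add_mul ((1 + 2 * g) * ((N : ℝ) + 1) ^ 2)]
      refine add_le_add ?_ ?_
      · refine mul_le_mul_of_nonneg_right ?_ hB0
        exact le_mul_of_one_le_right (by positivity) h4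
      · rw [mul_assoc (1 / g)]
        gcongr
        exact h2.trans (mul_le_mul_of_nonneg_right h3 hB0)
    have h6 : K * ((N : ℝ) + 1) ^ 2 * B = ((1 + 2 * g) * ((N : ℝ) + 1) ^ 2
        + 1 / g * ((2 * g + 1) * ((N : ℝ) + 1) ^ 2)) * B / g := by rw [hK]; ring
    rw [h6, le_div_iff₀ hg]; linarith
  -- The boundary layer has width of order `N^(-2)`; the factor `2` makes its contribution at most
  -- `B/2`, which is absorbed on the left.
  set R : ℝ := 2 * K * ((N : ℝ) + 1) ^ 2 with hR
  have hRpos : 0 < R := by positivity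
  have iA : IntervalIntegrable (fun x => wt (g - 1) x * jacobiComb g N a x ^ 2) volume (-1) 1 :=
    (intervalIntegrable_wt (by linarith)).mul_continuousOn (hpc.pow 2).continuousOn
  have iB : IntervalIntegrable (fun x => wt g x * jacobiComb g N a x ^ 2) volume (-1) 1 :=
    ((continuous_wt hg.le).mul (hpc.pow 2)).intervalIntegrable _ _
  have iI : IntervalIntegrable (fun x => wt (2 * g) x * jacobiComb g N a x ^ 2) volume (-1) 1 :=
    ((continuous_wt (by linarith)).mul (hpc.pow 2)).intervalIntegrable _ _
  have hle : B ≤ R ^ g * I + R⁻¹ * A := by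
    rw [hA, hI, ← intervalIntegral.integral_const_mul, ← intervalIntegral.integral_const_mul,
      ← intervalIntegral.integral_add (iI.const_mul _) (iA.const_mul _)]
    refine intervalIntegral.integral_mono_on_of_le_Ioo (by norm_num) iB
      ((iI.const_mul _).add (iA.const_mul _)) fun x hx => ?_
    have := wt_le_rpow_mul_add hg.le hRpos hx
    have := mul_le_mul_of_nonneg_right this (sq_nonneg (jacobiComb g N a x))
    linarith
  have hRA : R⁻¹ * A ≤ B / 2 := by
    rw [inv_mul_le_iff₀ hRpos, hR]; linarith
  have hRg : R ^ g = (2 * K) ^ g * ((N : ℝ) + 1) ^ (2 * g) := by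
    rw [hR, Real.mul_rpow (by positivity) (by positivity), Real.rpow_mul (by positivity)]
    norm_num
  rw [hRg] at hle
  linarith

/-! ### Change of basis between Jacobi families. -/

/-- `jacobiComb` as a linear map in the coefficients. -/
def jacobiCombLin (b : ℝ) (N : ℕ) : (ℕ → ℝ) →ₗ[ℝ] (ℝ → ℝ) where
  toFun := jacobiComb b N
  map_add' u v := by
    ext x; simp [jacobiComb, add_mul, Finset.sum_add_distrib]
  map_smul' c u := by
    ext x; simp [jacobiComb, Finset.mul_sum, mul_assoc]

theorem jacobiP_mem_range (b : ℝ) {N n : ℕ} (hn : n ≤ N) :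
    jacobiP b b n ∈ LinearMap.range (jacobiCombLin b N) := by
  refine ⟨Pi.single n 1, ?_⟩
  ext x
  change jacobiComb b N _ x = _
  rw [jacobiComb, Finset.sum_eq_single n]
  · simp
  · intro m _ hm; simp [Pi.single_eq_of_ne hm]
  · intro h; exact absurd (Finset.mem_range.2 (Nat.lt_succ_iff.2 hn)) h

theorem jacobiP_eq_sum_fun (b : ℝ) (n : ℕ) :
    jacobiP b b n = ∑ k ∈ Finset.range (n + 1),
      jacobiCoeff b n k • fun x : ℝ => ((x - 1) / 2) ^ k := by
  ext x; rw [jacobiP_eq_sum]; simp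

theorem jacobiCoeff_self_pos {b : ℝ} (hb : 0 ≤ b) (n : ℕ) : 0 < jacobiCoeff b n n := by
  have := ascPochhammer_eval_pos (show (0 : ℝ) < n + b + b + 1 by positivity) n
  unfold jacobiCoeff
  simp only [Nat.sub_self, ascPochhammer_zero, Polynomial.eval_one]
  positivity

/-- Triangularity: the leading coefficient of each `P_k^{b,b}` is nonzero. -/
theorem monomial_mem_range {b : ℝ} (hb : 0 ≤ b) {N k : ℕ} (hk : k ≤ N) :
    (fun x : ℝ => ((x - 1) / 2) ^ k) ∈ LinearMap.range (jacobiCombLin b N) := by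
  induction k using Nat.strong_induction_on with
  | _ k ih =>
    have hc := (jacobiCoeff_self_pos hb k).ne'
    have h := jacobiP_eq_sum_fun b k
    rw [Finset.sum_range_succ] at h
    have e : (fun x : ℝ => ((x - 1) / 2) ^ k) = (jacobiCoeff b k k)⁻¹ • (jacobiP b b k
        - ∑ j ∈ Finset.range k, jacobiCoeff b k j • fun x : ℝ => ((x - 1) / 2) ^ j) := by
      rw [h, add_sub_cancel_left, smul_smul, inv_mul_cancel₀ hc, one_smul]
    rw [e]
    refine Submodule.smul_mem _ _ (Submodule.sub_mem _ (jacobiP_mem_range b hk)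
      (Submodule.sum_mem _ fun j hj => Submodule.smul_mem _ _ ?_))
    have := Finset.mem_range.1 hj
    exact ih j this (by omega)

theorem exists_jacobiComb_eq {b : ℝ} (hb : 0 ≤ b) (c : ℝ) (N : ℕ) (a : ℕ → ℝ) :
    ∃ u : ℕ → ℝ, jacobiComb b N u = jacobiComb c N a := by
  have h : jacobiComb c N a = ∑ n ∈ Finset.range (N + 1), a n • jacobiP c c n := by
    ext x; simp [jacobiComb]
  have : jacobiComb c N a ∈ LinearMap.range (jacobiCombLin b N) := by
    rw [h]
    refine Submodule.sum_mem _ fun n hn => Submodule.smul_mem _ _ ?_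
    rw [jacobiP_eq_sum_fun]
    refine Submodule.sum_mem _ fun k hk => Submodule.smul_mem _ _ (monomial_mem_range hb ?_)
    have := Finset.mem_range.1 hn
    have := Finset.mem_range.1 hk
    omega
  exact this

/-! ### Two-sided bounds for the quadratic form of the mass matrix. -/

/-- The normalisation constant of `basisFun`. -/
def basisConst (α : ℝ) (n : ℕ) : ℝ :=
  Real.sqrt (2 * n + 2 * α + 1) * (n.factorial : ℝ)
      / ((2 : ℝ) ^ (α + 1 / 2) * Real.Gamma (n + α + 1))

theorem Gamma_natCast_add {a : ℝ} (ha : 0 < a) (n : ℕ) :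
    Real.Gamma (n + a) = (ascPochhammer ℝ n).eval a * Real.Gamma a := by
  induction n with
  | zero => simp
  | succ n ih =>
    have : ((n + 1 : ℕ) : ℝ) + a = n + a + 1 := by push_cast; ring
    rw [this, Real.Gamma_add_one (by positivity), ih, ascPochhammer_succ_eval]; ring

theorem basisConst_eq {α : ℝ} (hα : 0 < α) (n : ℕ) :
    basisConst α n = Real.sqrt (2 * n + 2 * α + 1) * (n.factorial : ℝ)
      / ((2 : ℝ) ^ (α + 1 / 2) * ((ascPochhammer ℝ n).eval (α + 1) * Real.Gamma (α + 1))) := by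
  rw [basisConst, add_assoc (n : ℝ) α 1, Gamma_natCast_add (by linarith)]

theorem basisConst_pos {α : ℝ} (hα : 0 < α) (n : ℕ) : 0 < basisConst α n := by
  have := Real.Gamma_pos_of_pos (show 0 < n + α + 1 by positivity)
  unfold basisConst
  positivity

theorem basisConst_sq_mul_jacobiInner {α : ℝ} (hα : 0 < α) (n : ℕ) :
    basisConst α n ^ 2 * jacobiInner α n n
      = wtMass α * (2 * α + 1) / (((2 : ℝ) ^ (α + 1 / 2)) ^ 2 * Real.Gamma (α + 1) ^ 2)
        * (n.factorial / (ascPochhammer ℝ n).eval (2 * α + 1)) := by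
  rw [basisConst_eq hα, jacobiInner_self α hα.le, div_pow, mul_pow, Real.sq_sqrt (by positivity)]
  have := Real.Gamma_pos_of_pos (show 0 < α + 1 by positivity)
  have := ascPochhammer_eval_pos (show 0 < α + 1 by linarith) n
  have := ascPochhammer_eval_pos (show 0 < 2 * α + 1 by linarith) n
  have := Nat.factorial_ne_zero n
  have : (0 : ℝ) < 2 ^ (α + 1 / 2) := by positivity
  have : (0 : ℝ) < 2 * n + 2 * α + 1 := by positivity
  field_simp

/-- The factorials and Pochhammer symbols cancel, so these squared endpoint values grow only
linearly in `n` and their sum up to `N` is `O(N²)`. -/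
theorem basisConst_mul_jacobiP_one {α : ℝ} (hα : 0 < α) (n : ℕ) :
    (basisConst α n * jacobiP α α n 1) ^ 2
      = (2 * n + 2 * α + 1) / (((2 : ℝ) ^ (α + 1 / 2)) ^ 2 * Real.Gamma (α + 1) ^ 2) := by
  rw [basisConst_eq hα, jacobiP_one]
  have h1 := Real.sq_sqrt (show 0 ≤ 2 * (n : ℝ) + 2 * α + 1 by positivity)
  have := Real.Gamma_pos_of_pos (show 0 < α + 1 by positivity)
  have := ascPochhammer_eval_pos (show 0 < α + 1 by linarith) n
  have := Nat.factorial_ne_zero n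
  have : (0 : ℝ) < 2 ^ (α + 1 / 2) := by positivity
  rw [div_mul_div_comm, div_pow, mul_pow, mul_pow, h1]
  field_simp

/-- The quadratic form `b(u, u)` in the coordinates with respect to the basis `φ_n`. -/
def massForm (α : ℝ) (N : ℕ) (u : ℕ → ℝ) : ℝ :=
  ∫ x in (-1 : ℝ)..1, wt (2 * α) x * jacobiComb α N (fun n => u n * basisConst α n) x ^ 2

/-- One factor `N^(-2α)` comes from the inverse inequality, the other from the smallest normalised
norm `n!/(2α+1)_n`, `n ≤ N`. -/
theorem exists_le_massForm {α : ℝ} (hα : 0 < α) :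
    ∃ c : ℝ, 0 < c ∧ ∀ (N : ℕ) (u : ℕ → ℝ),
      c * ((N : ℝ) + 1) ^ (-(4 * α)) * ∑ n ∈ Finset.range (N + 1), u n ^ 2 ≤ massForm α N u := by
  obtain ⟨C, hC, hB⟩ := exists_integral_wt_le_integral_wt_two_mul hα
  obtain ⟨_, D, _, hD, hρ⟩ := exists_bounds_ascPochhammer_div_factorial
    (show 0 < 2 * α by linarith)
  set C0 := wtMass α * (2 * α + 1) / (((2 : ℝ) ^ (α + 1 / 2)) ^ 2 * Real.Gamma (α + 1) ^ 2)
    with hC0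
  have hC0pos : 0 < C0 := by
    have := wtMass_pos hα.le
    have := Real.Gamma_pos_of_pos (show 0 < α + 1 by positivity)
    positivity
  refine ⟨C0 / (C * D), by positivity, fun N u => ?_⟩
  have h := hB N (fun n => u n * basisConst α n)
  rw [integral_wt_mul_jacobiComb_sq α hα.le] at h
  have hN : (0 : ℝ) < ((N : ℝ) + 1) ^ (2 * α) := by positivity
  have hlow : C0 / (D * ((N : ℝ) + 1) ^ (2 * α)) * ∑ n ∈ Finset.range (N + 1), u n ^ 2
      ≤ ∑ n ∈ Finset.range (N + 1), (u n * basisConst α n) ^ 2 * jacobiInner α n n := by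
    rw [Finset.mul_sum]
    refine Finset.sum_le_sum fun n hn => ?_
    have hnN : (n : ℝ) ≤ N := by exact_mod_cast Nat.lt_succ_iff.1 (Finset.mem_range.1 hn)
    rw [mul_pow, mul_assoc, basisConst_sq_mul_jacobiInner hα, ← hC0,
      mul_comm (u n ^ 2)]
    refine mul_le_mul_of_nonneg_right ?_ (sq_nonneg _)
    rw [div_eq_mul_inv]
    refine mul_le_mul_of_nonneg_left ?_ hC0pos.le
    have hp := ascPochhammer_eval_pos (show 0 < 2 * α + 1 by linarith) n
    rw [← inv_div]
    refine inv_anti₀ (by positivity) ((hρ n).2.trans ?_)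
    gcongr
  have h4 : ((N : ℝ) + 1) ^ (-(4 * α))
      = (((N : ℝ) + 1) ^ (2 * α))⁻¹ * (((N : ℝ) + 1) ^ (2 * α))⁻¹ := by
    rw [← Real.rpow_neg (by positivity), ← Real.rpow_add (by positivity)]; ring_nf
  have h5 := hlow.trans h
  rw [massForm, h4]
  set S := ∑ n ∈ Finset.range (N + 1), u n ^ 2
  have h6 : C0 / (C * D) * ((((N : ℝ) + 1) ^ (2 * α))⁻¹ * (((N : ℝ) + 1) ^ (2 * α))⁻¹) * S
      = C0 / (D * ((N : ℝ) + 1) ^ (2 * α)) * S / (C * ((N : ℝ) + 1) ^ (2 * α)) := by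
    field_simp
  rw [h6, div_le_iff₀ (by positivity)]
  linarith

theorem factorial_le_ascPochhammer {s : ℝ} (hs : 0 ≤ s) (n : ℕ) :
    (n.factorial : ℝ) ≤ (ascPochhammer ℝ n).eval (s + 1) := by
  induction n with
  | zero => simp
  | succ n ih =>
    rw [ascPochhammer_succ_eval, Nat.factorial_succ, Nat.cast_mul, mul_comm]
    push_cast
    refine mul_le_mul ih (by linarith) (by positivity) (ascPochhammer_eval_pos (by linarith) n).le

theorem wt_two_mul_le {α x : ℝ} (hα : 0 ≤ α) (hx : x ∈ Icc (-1 : ℝ) 1) :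
    wt (2 * α) x ≤ wt α x := by
  have h0 : 0 ≤ 1 - x ^ 2 := by nlinarith [hx.1, hx.2]
  have h1 : wt α x ≤ 1 := Real.rpow_le_one h0 (by nlinarith) hα
  have h2 : wt (2 * α) x = wt α x * wt α x := by
    rw [wt, wt, two_mul, Real.rpow_add_of_nonneg h0 hα hα]
  rw [h2]
  exact mul_le_of_le_one_left (wt_nonneg α hx) h1

theorem exists_massForm_le {α : ℝ} (hα : 0 < α) :
    ∃ C : ℝ, 0 < C ∧ ∀ (N : ℕ) (u : ℕ → ℝ),
      massForm α N u ≤ C * ∑ n ∈ Finset.range (N + 1), u n ^ 2 := by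
  set C0 := wtMass α * (2 * α + 1) / (((2 : ℝ) ^ (α + 1 / 2)) ^ 2 * Real.Gamma (α + 1) ^ 2)
    with hC0
  have hC0pos : 0 < C0 := by
    have := wtMass_pos hα.le
    have := Real.Gamma_pos_of_pos (show 0 < α + 1 by positivity)
    positivity
  refine ⟨C0, hC0pos, fun N u => ?_⟩
  have hpc := continuous_jacobiComb α N (fun n => u n * basisConst α n)
  calc massForm α N u ≤ ∫ x in (-1 : ℝ)..1,
        wt α x * jacobiComb α N (fun n => u n * basisConst α n) x ^ 2 :=
        intervalIntegral.integral_mono_on (by norm_num)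
          (((continuous_wt (by linarith)).mul (hpc.pow 2)).intervalIntegrable _ _)
          (((continuous_wt hα.le).mul (hpc.pow 2)).intervalIntegrable _ _)
          fun x hx => mul_le_mul_of_nonneg_right (wt_two_mul_le hα.le hx) (sq_nonneg _)
    _ ≤ _ := by
        rw [integral_wt_mul_jacobiComb_sq α hα.le, Finset.mul_sum]
        refine Finset.sum_le_sum fun n _ => ?_
        rw [mul_pow, mul_assoc, basisConst_sq_mul_jacobiInner hα, ← hC0, mul_comm (u n ^ 2)]
        refine mul_le_mul_of_nonneg_right (mul_le_of_le_one_right hC0pos.le ?_) (sq_nonneg _)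
        exact div_le_one_of_le₀ (factorial_le_ascPochhammer (by linarith) n)
          (ascPochhammer_eval_pos (by linarith) n).le

theorem jacobiP_one_sq_div_jacobiInner {b : ℝ} (hb : 0 ≤ b) (n : ℕ) :
    jacobiP b b n 1 ^ 2 / jacobiInner b n n
      = (wtMass b * (2 * b + 1))⁻¹ *
        ((2 * n + 2 * b + 1) * (ascPochhammer ℝ n).eval (2 * b + 1) / n.factorial) := by
  rw [jacobiP_one, jacobiInner_self b hb]
  have := wtMass_pos hb
  have := ascPochhammer_eval_pos (show 0 < b + 1 by linarith) n
  have := ascPochhammer_eval_pos (show 0 < 2 * b + 1 by linarith) n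
  have := Nat.factorial_ne_zero n
  have : (0 : ℝ) < 2 * n + 2 * b + 1 := by positivity
  field_simp

/-- Closed form of the reproducing kernel at `(1,1)`, up to the factor in
`jacobiP_one_sq_div_jacobiInner`; the sum telescopes. -/
theorem sum_mul_ascPochhammer_div_factorial {b : ℝ} (hb : 0 ≤ b) (N : ℕ) :
    ∑ n ∈ Finset.range (N + 1),
        (2 * n + 2 * b + 1) * (ascPochhammer ℝ n).eval (2 * b + 1) / n.factorial
      = (2 * b + 1) * (N + b + 1) / (b + 1) *
        ((ascPochhammer ℝ N).eval (2 * b + 1 + 1) / N.factorial) := by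
  induction N with
  | zero => simp; field_simp
  | succ N ih =>
    rw [Finset.sum_range_succ, ih, ascPochhammer_eval_succ_left, ascPochhammer_succ_eval,
      Nat.factorial_succ]
    have := Nat.factorial_ne_zero N
    have : 0 < b + 1 := by linarith
    push_cast
    field_simp
    ring

/-- The diagonal value at the endpoint `1` of the reproducing kernel of polynomials of degree at
most `N` (the reciprocal of the Christoffel function). -/
theorem exists_le_sum_jacobiP_one_sq {b : ℝ} (hb : 0 ≤ b) :
    ∃ c : ℝ, 0 < c ∧ ∀ N : ℕ, c * ((N : ℝ) + 1) ^ (2 * b + 2)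
      ≤ ∑ n ∈ Finset.range (N + 1), jacobiP b b n 1 ^ 2 / jacobiInner b n n := by
  obtain ⟨c, _, hc, _, hρ⟩ := exists_bounds_ascPochhammer_div_factorial
    (show 0 < 2 * b + 1 by linarith)
  have hM := wtMass_pos hb
  refine ⟨c / (wtMass b * (b + 1)), by positivity, fun N => ?_⟩
  simp only [jacobiP_one_sq_div_jacobiInner hb, ← Finset.mul_sum]
  rw [sum_mul_ascPochhammer_div_factorial hb]
  have e : ((N : ℝ) + 1) ^ (2 * b + 2) = ((N : ℝ) + 1) ^ (2 * b + 1) * (N + 1) := by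
    rw [← Real.rpow_add_one (by positivity)]; ring_nf
  have h1 := (hρ N).1
  have h2 : c * ((N : ℝ) + 1) ^ (2 * b + 1) * (N + 1)
      ≤ (ascPochhammer ℝ N).eval (2 * b + 1 + 1) / N.factorial * (N + b + 1) := by
    gcongr
    · exact le_trans (by positivity) h1
    · linarith
  have e2 : (wtMass b * (2 * b + 1))⁻¹ * ((2 * b + 1) * (N + b + 1) / (b + 1) *
        ((ascPochhammer ℝ N).eval (2 * b + 1 + 1) / N.factorial))
      = (ascPochhammer ℝ N).eval (2 * b + 1 + 1) / N.factorial * (N + b + 1)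
        / (wtMass b * (b + 1)) := by
    field_simp
  rw [e2, e, div_mul_eq_mul_div, ← mul_assoc]
  gcongr

/-- Let `p` be the reproducing kernel at `1` for `(1-x²)^(2α)`. Then the form at `p` and the value
`p(1)` both equal `K ≳ N^(4α+2)`. Evaluating `p(1)` in the basis `φ_n` and using Cauchy–Schwarz
gives `K² ≲ N² ∑ u_n²`, so the quotient is `≲ N²/K`. -/
theorem exists_massForm_le_of_kernel {α : ℝ} (hα : 0 < α) :
    ∃ C : ℝ, 0 < C ∧ ∀ N : ℕ, ∃ u : ℕ → ℝ,
      0 < ∑ n ∈ Finset.range (N + 1), u n ^ 2 ∧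
      massForm α N u ≤
        C * ((N : ℝ) + 1) ^ (-(4 * α)) * ∑ n ∈ Finset.range (N + 1), u n ^ 2 := by
  have hβ : 0 ≤ 2 * α := by linarith
  obtain ⟨c, hc, hK⟩ := exists_le_sum_jacobiP_one_sq hβ
  set G := ((2 : ℝ) ^ (α + 1 / 2)) ^ 2 * Real.Gamma (α + 1) ^ 2 with hG
  have hGpos : 0 < G := by
    have := Real.Gamma_pos_of_pos (show 0 < α + 1 by positivity)
    positivity
  refine ⟨(2 * α + 2) / (G * c), by positivity, fun N => ?_⟩
  set a : ℕ → ℝ := fun n => jacobiP (2 * α) (2 * α) n 1 / jacobiInner (2 * α) n n with ha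
  obtain ⟨v, hv⟩ := exists_jacobiComb_eq hα.le (2 * α) N a
  set u : ℕ → ℝ := fun n => v n / basisConst α n with hu
  -- The kernel is a combination of `P_n^{2α,2α}`; re-expanded in `P_n^{α,α}` and divided by the
  -- normalisation, its coefficients are the coordinates `u`.
  have huv : (fun n => u n * basisConst α n) = v := by
    ext n; exact div_mul_cancel₀ _ (basisConst_pos hα n).ne'
  set K := ∑ n ∈ Finset.range (N + 1),
    jacobiP (2 * α) (2 * α) n 1 ^ 2 / jacobiInner (2 * α) n n with hKdef
  have hKN := hK N
  rw [← hKdef] at hKN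
  have hKpos : 0 < K := lt_of_lt_of_le (by positivity) hKN
  have hform : massForm α N u = K := by
    rw [massForm, huv, hv, integral_wt_mul_jacobiComb_sq _ hβ]
    refine Finset.sum_congr rfl fun n _ => ?_
    have := (jacobiInner_self_pos (2 * α) hβ n).ne'
    simp only [ha]
    field_simp
  have hone : jacobiComb α N v 1 = K := by
    rw [hv, jacobiComb]
    refine Finset.sum_congr rfl fun n _ => ?_
    simp only [ha]; ring
  have hCS : K ^ 2 ≤ (∑ n ∈ Finset.range (N + 1), u n ^ 2) *
      ((2 * α + 2) * ((N : ℝ) + 1) ^ 2 / G) := by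
    have h := Finset.sum_mul_sq_le_sq_mul_sq (Finset.range (N + 1)) u
      (fun n => basisConst α n * jacobiP α α n 1)
    have e : ∑ n ∈ Finset.range (N + 1), u n * (basisConst α n * jacobiP α α n 1) = K := by
      rw [← hone, ← huv, jacobiComb]
      exact Finset.sum_congr rfl fun n _ => by ring
    rw [e] at h
    refine h.trans (mul_le_mul_of_nonneg_left ?_ (Finset.sum_nonneg fun n _ => sq_nonneg _))
    calc ∑ n ∈ Finset.range (N + 1), (basisConst α n * jacobiP α α n 1) ^ 2
        ≤ ∑ n ∈ Finset.range (N + 1), (2 * α + 2) * ((N : ℝ) + 1) / G := by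
          refine Finset.sum_le_sum fun n hn => ?_
          have hnN : (n : ℝ) ≤ N := by
            exact_mod_cast Nat.lt_succ_iff.1 (Finset.mem_range.1 hn)
          have hN0 : (0 : ℝ) ≤ N := Nat.cast_nonneg N
          rw [basisConst_mul_jacobiP_one hα, ← hG]
          gcongr
          nlinarith
      _ = _ := by
          rw [Finset.sum_const, Finset.card_range, nsmul_eq_mul]; push_cast; ring
  set S := ∑ n ∈ Finset.range (N + 1), u n ^ 2 with hS
  have hSpos : 0 < S := by
    by_contra h
    have : S * ((2 * α + 2) * ((N : ℝ) + 1) ^ 2 / G) ≤ 0 :=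
      mul_nonpos_of_nonpos_of_nonneg (not_lt.1 h) (by positivity)
    nlinarith
  refine ⟨u, hSpos, ?_⟩
  rw [hform]
  have h1 : K * (c * ((N : ℝ) + 1) ^ (2 * (2 * α) + 2))
      ≤ S * ((2 * α + 2) * ((N : ℝ) + 1) ^ 2 / G) :=
    (mul_le_mul_of_nonneg_left hKN hKpos.le).trans (by rw [← sq]; exact hCS)
  have e1 : ((N : ℝ) + 1) ^ (2 * (2 * α) + 2) = ((N : ℝ) + 1) ^ (4 * α) * ((N : ℝ) + 1) ^ 2 := by
    rw [Real.rpow_add (by positivity), ← mul_assoc]; norm_num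
  rw [e1] at h1
  rw [Real.rpow_neg (by positivity)]
  have hp : (0 : ℝ) < ((N : ℝ) + 1) ^ (4 * α) := by positivity
  have hp2 : (0 : ℝ) < ((N : ℝ) + 1) ^ 2 := by positivity
  have e2 : (2 * α + 2) / (G * c) * (((N : ℝ) + 1) ^ (4 * α))⁻¹ * S
      = S * ((2 * α + 2) * ((N : ℝ) + 1) ^ 2 / G)
        / (c * (((N : ℝ) + 1) ^ (4 * α) * ((N : ℝ) + 1) ^ 2)) := by
    field_simp
  rw [e2, le_div_iff₀ (by positivity)]
  exact h1

/-! ### Bessel functions through Poisson's integral: recurrences and decay. -/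

/-- The cosine transform of the weight `(1 - x²)^g`. -/
def wtCos (g t : ℝ) : ℝ := ∫ x in (-1 : ℝ)..1, wt g x * Real.cos (t * x)

theorem hasDerivAt_wtCos_sin {g : ℝ} (hg : 0 ≤ g) (t : ℝ) :
    HasDerivAt (wtCos g) (-∫ x in (-1 : ℝ)..1, x * wt g x * Real.sin (t * x)) t := by
  have hw := continuous_wt hg
  have h := (intervalIntegral.hasDerivAt_integral_of_dominated_loc_of_deriv_le
    (μ := volume) (a := (-1 : ℝ)) (b := 1) (F := fun t x => wt g x * Real.cos (t * x))
    (F' := fun t x => -(x * wt g x * Real.sin (t * x))) (x₀ := t) (s := univ)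
    (bound := fun x => |x * wt g x|) univ_mem
    (Eventually.of_forall fun t => (by fun_prop : Continuous fun x =>
      wt g x * Real.cos (t * x)).aestronglyMeasurable)
    ((by fun_prop : Continuous fun x => wt g x * Real.cos (t * x)).intervalIntegrable _ _)
    ((by fun_prop : Continuous fun x => -(x * wt g x * Real.sin (t * x))).aestronglyMeasurable)
    (Eventually.of_forall fun x _ t _ => by
      rw [norm_neg, Real.norm_eq_abs, abs_mul]
      exact mul_le_of_le_one_right (abs_nonneg _) (Real.abs_sin_le_one _))
    ((by fun_prop : Continuous fun x => |x * wt g x|).intervalIntegrable _ _)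
    (Eventually.of_forall fun x _ t _ => by
      have h1 : HasDerivAt (fun t : ℝ => t * x) x t := by
        simpa using (hasDerivAt_id t).mul_const x
      refine (h1.cos.const_mul (wt g x)).congr_deriv ?_
      ring)).2
  rw [← intervalIntegral.integral_neg]
  exact h

theorem continuous_wtCos {g : ℝ} (hg : 0 ≤ g) : Continuous (wtCos g) :=
  continuous_iff_continuousAt.2 fun t => (hasDerivAt_wtCos_sin hg t).continuousAt

theorem hasDerivAt_wtCos {g : ℝ} (hg : 0 ≤ g) (t : ℝ) :
    HasDerivAt (wtCos g) (-(t / (2 * (g + 1))) * wtCos (g + 1) t) t := by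
  refine (hasDerivAt_wtCos_sin hg t).congr_deriv ?_
  have hw := continuous_wt hg
  have hw1 := continuous_wt (show 0 ≤ g + 1 by linarith)
  have hs : ∀ x, HasDerivAt (fun x => Real.sin (t * x)) (t * Real.cos (t * x)) x := fun x => by
    have h1 : HasDerivAt (fun x : ℝ => t * x) t x := by
      simpa using (hasDerivAt_id x).const_mul t
    exact h1.sin.congr_deriv (by ring)
  have h := intervalIntegral.integral_mul_deriv_eq_deriv_mul (a := (-1 : ℝ)) (b := 1)
    (fun x _ => hs x) (fun x _ => hasDerivAt_wt_succ hg x)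
    ((by fun_prop : Continuous fun x => t * Real.cos (t * x)).intervalIntegrable _ _)
    ((by fun_prop : Continuous fun x => -2 * (g + 1) * x * wt g x).intervalIntegrable _ _)
  rw [wt_apply_one (by linarith), wt_apply_neg_one (by linarith)] at h
  have e1 : ∀ x, Real.sin (t * x) * (-2 * (g + 1) * x * wt g x)
      = (-2 * (g + 1)) * (x * wt g x * Real.sin (t * x)) := fun x => by ring
  have e2 : ∀ x, t * Real.cos (t * x) * wt (g + 1) x
      = t * (wt (g + 1) x * Real.cos (t * x)) := fun x => by ring
  simp only [e1, e2, intervalIntegral.integral_const_mul, mul_zero, zero_sub, sub_zero] at h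
  rw [wtCos, neg_mul, neg_inj, div_mul_eq_mul_div, eq_div_iff (by linarith)]
  linarith

/-- Integrate `cos(tx)` against the derivative of `x (1-x²)^(g+1)`. With `hasDerivAt_wtCos` this
yields the two first-order Bessel recurrences. -/
theorem mul_wtCos_deriv {g : ℝ} (hg : 0 ≤ g) {t d : ℝ} (hd : HasDerivAt (wtCos (g + 1)) d t) :
    t * d = -(2 * g + 3) * wtCos (g + 1) t + 2 * (g + 1) * wtCos g t := by
  have hw := continuous_wt hg
  have hw1 := continuous_wt (show 0 ≤ g + 1 by linarith)
  have hc : ∀ x, HasDerivAt (fun x => Real.cos (t * x)) (-(t * Real.sin (t * x))) x := fun x => by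
    have h1 : HasDerivAt (fun x : ℝ => t * x) t x := by
      simpa using (hasDerivAt_id x).const_mul t
    exact h1.cos.congr_deriv (by ring)
  have hx : ∀ x, HasDerivAt (fun x => x * wt (g + 1) x)
      ((2 * g + 3) * wt (g + 1) x - 2 * (g + 1) * wt g x) x := fun x => by
    refine ((hasDerivAt_id x).mul (hasDerivAt_wt_succ hg x)).congr_deriv ?_
    rw [wt_succ hg, id]; ring
  have h := intervalIntegral.integral_mul_deriv_eq_deriv_mul (a := (-1 : ℝ)) (b := 1)
    (fun x _ => hc x) (fun x _ => hx x)
    ((by fun_prop : Continuous fun x => -(t * Real.sin (t * x))).intervalIntegrable _ _)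
    ((by fun_prop : Continuous fun x =>
      (2 * g + 3) * wt (g + 1) x - 2 * (g + 1) * wt g x).intervalIntegrable _ _)
  rw [wt_apply_one (by linarith), wt_apply_neg_one (by linarith)] at h
  have e1 : ∀ x, Real.cos (t * x) * ((2 * g + 3) * wt (g + 1) x - 2 * (g + 1) * wt g x)
      = (2 * g + 3) * (wt (g + 1) x * Real.cos (t * x))
        - 2 * (g + 1) * (wt g x * Real.cos (t * x)) := fun x => by ring
  have e2 : ∀ x, -(t * Real.sin (t * x)) * (x * wt (g + 1) x)
      = (-t) * (x * wt (g + 1) x * Real.sin (t * x)) := fun x => by ring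
  simp only [e1, e2, intervalIntegral.integral_const_mul, mul_zero] at h
  rw [intervalIntegral.integral_sub ((by fun_prop : Continuous fun x =>
      (2 * g + 3) * (wt (g + 1) x * Real.cos (t * x))).intervalIntegrable _ _)
    ((by fun_prop : Continuous fun x =>
      2 * (g + 1) * (wt g x * Real.cos (t * x))).intervalIntegrable _ _),
    intervalIntegral.integral_const_mul, intervalIntegral.integral_const_mul] at h
  rw [hd.unique (hasDerivAt_wtCos_sin (by linarith) t)]
  simp only [wtCos]
  linarith

theorem wtCos_neg (g t : ℝ) : wtCos g (-t) = wtCos g t := by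
  simp [wtCos, neg_mul, Real.cos_neg]

theorem wtCos_pos {g t : ℝ} (hg : 0 ≤ g) (ht : t ∈ Icc (0 : ℝ) 1) : 0 < wtCos g t := by
  have hw := continuous_wt hg
  refine intervalIntegral.intervalIntegral_pos_of_pos_on
    ((by fun_prop : Continuous fun x => wt g x * Real.cos (t * x)).intervalIntegrable _ _)
    (fun x hx => mul_pos (wt_pos g hx) (Real.cos_pos_of_le_one ?_)) (by norm_num)
  rw [abs_mul]
  exact mul_le_one₀ (abs_le.2 ⟨by linarith [ht.1], ht.2⟩) (abs_nonneg _)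
    (abs_le.2 ⟨hx.1.le, hx.2.le⟩)

/-- Up to a constant factor independent of `n`, the Bessel function of order `n + α + 1/2` in
Poisson's integral representation. -/
def besselP (α : ℝ) (n : ℕ) (t : ℝ) : ℝ :=
  t ^ (n + α + 1 / 2) * wtCos (n + α) t / (2 ^ n * Real.Gamma (n + α + 1))

theorem continuous_besselP {α : ℝ} (hα : 0 < α) (n : ℕ) : Continuous (besselP α n) :=
  ((Real.continuous_rpow_const (by positivity)).mul
    (continuous_wtCos (by positivity))).div_const _

theorem besselP_zero {α : ℝ} (hα : 0 < α) (n : ℕ) : besselP α n 0 = 0 := by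
  rw [besselP, Real.zero_rpow (by positivity), zero_mul, zero_div]

theorem hasDerivAt_besselP {α : ℝ} (hα : 0 < α) (n : ℕ) {t : ℝ} (ht : 0 < t) :
    HasDerivAt (besselP α n)
      ((n + α + 1 / 2) / t * besselP α n t - besselP α (n + 1) t) t := by
  have hg : (0 : ℝ) ≤ n + α := by positivity
  have h := ((Real.hasDerivAt_rpow_const (p := n + α + 1 / 2) (Or.inl ht.ne')).mul
    (hasDerivAt_wtCos hg t)).div_const (2 ^ n * Real.Gamma (n + α + 1))
  refine h.congr_deriv ?_
  have hG : Real.Gamma (((n + 1 : ℕ) : ℝ) + α + 1) = (n + α + 1) * Real.Gamma (n + α + 1) := by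
    rw [← Real.Gamma_add_one (by positivity)]; push_cast; ring_nf
  have hr1 : t ^ ((n : ℝ) + α + 1 / 2 - 1) = t ^ ((n : ℝ) + α + 1 / 2) / t := by
    rw [Real.rpow_sub_one ht.ne']
  have hr2 : t ^ (((n + 1 : ℕ) : ℝ) + α + 1 / 2) = t ^ ((n : ℝ) + α + 1 / 2) * t := by
    rw [← Real.rpow_add_one ht.ne']; push_cast; ring_nf
  have hw : ((n + 1 : ℕ) : ℝ) + α = n + α + 1 := by push_cast; ring
  have hGp := Real.Gamma_pos_of_pos (show (0 : ℝ) < n + α + 1 by positivity)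
  rw [besselP, besselP, hG, hr1, hr2, hw]
  have : (0 : ℝ) < n + α + 1 := by positivity
  field_simp
  ring

theorem hasDerivAt_besselP_succ {α : ℝ} (hα : 0 < α) (n : ℕ) {t : ℝ} (ht : 0 < t) :
    HasDerivAt (besselP α (n + 1))
      (besselP α n t - (n + α + 3 / 2) / t * besselP α (n + 1) t) t := by
  have hg : (0 : ℝ) ≤ n + α := by positivity
  have hw : ((n + 1 : ℕ) : ℝ) + α = n + α + 1 := by push_cast; ring
  have hd := hasDerivAt_wtCos_sin (show (0 : ℝ) ≤ n + α + 1 by positivity) t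
  have hdm := mul_wtCos_deriv hg hd
  generalize -∫ x in (-1 : ℝ)..1, x * wt (n + α + 1) x * Real.sin (t * x) = d at hd hdm
  have hd' : d = (-(2 * (n + α) + 3) * wtCos (n + α + 1) t
      + 2 * (n + α + 1) * wtCos (n + α) t) / t := by
    field_simp; linarith
  rw [← hw] at hd
  have h := ((Real.hasDerivAt_rpow_const (p := ((n + 1 : ℕ) : ℝ) + α + 1 / 2)
    (Or.inl ht.ne')).mul hd).div_const (2 ^ (n + 1) * Real.Gamma (((n + 1 : ℕ) : ℝ) + α + 1))
  refine h.congr_deriv ?_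
  have hG : Real.Gamma (((n + 1 : ℕ) : ℝ) + α + 1) = (n + α + 1) * Real.Gamma (n + α + 1) := by
    rw [← Real.Gamma_add_one (by positivity)]; push_cast; ring_nf
  have hr1 : t ^ (((n + 1 : ℕ) : ℝ) + α + 1 / 2 - 1) = t ^ ((n : ℝ) + α + 1 / 2) := by
    push_cast; ring_nf
  have hr2 : t ^ (((n + 1 : ℕ) : ℝ) + α + 1 / 2) = t ^ ((n : ℝ) + α + 1 / 2) * t := by
    rw [← Real.rpow_add_one ht.ne']; push_cast; ring_nf
  have hGp := Real.Gamma_pos_of_pos (show (0 : ℝ) < n + α + 1 by positivity)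
  rw [besselP, besselP, hG, hr1, hr2, hw, hd']
  have : (0 : ℝ) < n + α + 1 := by positivity
  field_simp
  ring

theorem besselP_add_besselP {α : ℝ} (hα : 0 < α) (n : ℕ) {t : ℝ} (ht : 0 < t) :
    besselP α n t + besselP α (n + 2) t = (2 * (n + α) + 3) * (besselP α (n + 1) t / t) := by
  have h := (hasDerivAt_besselP hα (n + 1) ht).unique (hasDerivAt_besselP_succ hα n ht)
  push_cast at h
  have : (n + 1 + α + 1 / 2) / t * besselP α (n + 1) t
      + (n + α + 3 / 2) / t * besselP α (n + 1) t
      = (2 * (n + α) + 3) * (besselP α (n + 1) t / t) := by ring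
  rw [show n + 1 + 1 = n + 2 from rfl] at h
  linarith

/-- The bound `J_ν² = O(1/t)` by an energy argument using only the first-order system for `(J_ν,
J_{ν+1})`. -/
theorem exists_besselP_sq_le {α : ℝ} (hα : 0 < α) (n : ℕ) :
    ∃ C M : ℝ, 0 < M ∧ ∀ t, M ≤ t → besselP α n t ^ 2 ≤ C / t := by
  set f := besselP α n with hf
  set h := besselP α (n + 1) with hh
  set M : ℝ := 2 * (n + α + 1 / 2) + 1 with hM
  have hMpos : 0 < M := by positivity
  -- With `ν = n + α + 1/2`, the derivative of `t(f² + h²)` is `(2ν+1)(f² - h²)` and that of `fh` is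
  -- `f² - h² - fh/t`; hence `M = 2ν + 1` leaves only `V' = M fh/t`.
  set V : ℝ → ℝ := fun t => t * (f t ^ 2 + h t ^ 2) - M * (f t * h t) with hV
  have hVd : ∀ t, 0 < t → HasDerivAt V (M * (f t * h t) / t) t := by
    intro t ht
    have h1 := hasDerivAt_besselP hα n ht
    have h2 := hasDerivAt_besselP_succ hα n ht
    rw [← hf, ← hh] at h1 h2
    refine (((hasDerivAt_id t).mul ((h1.pow 2).add (h2.pow 2))).sub
      ((h1.mul h2).const_mul M)).congr_deriv ?_
    simp only [id, Pi.add_apply, Pi.pow_apply]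
    rw [hM]
    push_cast
    field_simp
    ring
  have hVlow : ∀ t, M ≤ t → t / 2 * (f t ^ 2 + h t ^ 2) ≤ V t := by
    intro t ht
    have h1 : M * (f t * h t) ≤ t / 2 * (f t ^ 2 + h t ^ 2) := by
      have h2 : M * (f t * h t) ≤ M * ((f t ^ 2 + h t ^ 2) / 2) :=
        mul_le_mul_of_nonneg_left (by nlinarith [sq_nonneg (f t - h t)]) hMpos.le
      have h3 : M * ((f t ^ 2 + h t ^ 2) / 2) ≤ t * ((f t ^ 2 + h t ^ 2) / 2) :=
        mul_le_mul_of_nonneg_right ht (by positivity)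
      linarith
    simp only [hV]; linarith
  -- Since `V/t ≥ (f² + h²)/2 ≥ fh` for `t ≥ M`, one has `V' ≤ (M/t²) V`; `exp(M/t)` is the matching
  -- integrating factor and makes `F` decreasing.
  set F : ℝ → ℝ := fun t => V t * Real.exp (M / t) with hF
  have hFd : ∀ t, 0 < t → HasDerivAt F
      (Real.exp (M / t) * (M / t) * (f t * h t - V t / t)) t := by
    intro t ht
    have h1 : HasDerivAt (fun t : ℝ => M / t) (-(M / t ^ 2)) t := by
      have := (hasDerivAt_inv ht.ne').const_mul M
      refine (this.congr_deriv ?_)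
      ring
    refine ((hVd t ht).mul h1.exp).congr_deriv ?_
    field_simp
    ring
  have hanti : AntitoneOn F (Ici M) := by
    refine antitoneOn_of_deriv_nonpos (convex_Ici M)
      (fun t ht => (hFd t (hMpos.trans_le ht)).continuousAt.continuousWithinAt)
      (fun t ht => ?_) (fun t ht => ?_)
    · rw [interior_Ici] at ht
      exact (hFd t (hMpos.trans ht)).differentiableAt.differentiableWithinAt
    · rw [interior_Ici] at ht
      have ht0 : 0 < t := hMpos.trans ht
      rw [(hFd t ht0).deriv]
      refine mul_nonpos_of_nonneg_of_nonpos (by positivity) ?_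
      have h1 := hVlow t (le_of_lt ht)
      have h2 : (f t ^ 2 + h t ^ 2) / 2 ≤ V t / t := by
        rw [le_div_iff₀ ht0]; linarith
      nlinarith [sq_nonneg (f t - h t)]
  refine ⟨2 * F M, M, hMpos, fun t ht => ?_⟩
  have ht0 : 0 < t := hMpos.trans_le ht
  have h1 := hanti (mem_Ici.2 le_rfl) (mem_Ici.2 ht) ht
  have h2 := hVlow t ht
  have hV0 : 0 ≤ V t := le_trans (by positivity) h2
  have h3 : V t ≤ F t := le_mul_of_one_le_right hV0 (Real.one_le_exp (by positivity))
  rw [le_div_iff₀ ht0]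
  nlinarith [sq_nonneg (h t)]

theorem besselP_isBigO {α : ℝ} (hα : 0 < α) (n : ℕ) :
    besselP α n =O[atTop] fun t : ℝ => t ^ (-(1 / 2) : ℝ) := by
  obtain ⟨C, M, hM, h⟩ := exists_besselP_sq_le hα n
  refine IsBigO.of_bound (Real.sqrt C) ?_
  filter_upwards [eventually_ge_atTop M] with t ht
  have ht0 : 0 < t := hM.trans_le ht
  have h1 := Real.abs_le_sqrt (h t ht)
  rw [Real.norm_eq_abs, Real.norm_eq_abs, abs_of_pos (Real.rpow_pos_of_pos ht0 _), Real.rpow_neg ht0.le,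
    ← Real.sqrt_eq_rpow, ← div_eq_mul_inv]
  rwa [Real.sqrt_div' _ ht0.le] at h1

/-- By the three-term recurrence `J_{ν+2} = -J_ν + O(t^(-3/2))`. The extra decay is what kills the
boundary term at infinity in the orthogonality relation. -/
theorem besselP_add_two_mul_isBigO {α : ℝ} (hα : 0 < α) (n k : ℕ) :
    (fun t => besselP α (n + 2 * k) t - (-1) ^ k * besselP α n t)
      =O[atTop] fun t : ℝ => t ^ (-(3 / 2) : ℝ) := by
  induction k with
  | zero => simpa using isBigO_zero _ _
  | succ k ih =>
    have h1 : (fun t => (2 * ((n + 2 * k : ℕ) + α) + 3) * (besselP α (n + 2 * k + 1) t / t))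
        =O[atTop] fun t : ℝ => t ^ (-(3 / 2) : ℝ) := by
      refine IsBigO.const_mul_left ?_ _
      refine ((besselP_isBigO hα (n + 2 * k + 1)).mul
        (isBigO_refl (fun t : ℝ => t⁻¹) atTop)).congr' ?_ ?_
      · exact Eventually.of_forall fun t => (div_eq_mul_inv _ _).symm
      · filter_upwards [eventually_gt_atTop 0] with t ht
        rw [← Real.rpow_neg_one, ← Real.rpow_add ht]; norm_num
    refine (h1.sub ih).congr' ?_ EventuallyEq.rfl
    filter_upwards [eventually_gt_atTop 0] with t ht
    rw [← besselP_add_besselP hα (n + 2 * k) ht, pow_succ]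
    rw [show n + 2 * (k + 1) = n + 2 * k + 2 by ring]
    ring

/-! ### Orthogonality of Bessel functions with respect to `dt/t`. -/

/-- The integrand of the Weber–Schafheitlin type integral `∫ J_μ J_ν / t`. -/
def besselPair (α : ℝ) (m n : ℕ) (t : ℝ) : ℝ :=
  t ^ (m + n + 2 * α) * (wtCos (m + α) t * wtCos (n + α) t)
    / (2 ^ m * Real.Gamma (m + α + 1) * (2 ^ n * Real.Gamma (n + α + 1)))

theorem besselPair_eq {α : ℝ} (m n : ℕ) {t : ℝ} (ht : 0 < t) :
    besselPair α m n t = besselP α m t * besselP α n t / t := by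
  have : t ^ ((m : ℝ) + n + 2 * α) = t ^ ((m : ℝ) + α + 1 / 2) * t ^ ((n : ℝ) + α + 1 / 2) / t := by
    rw [← Real.rpow_add ht, ← Real.rpow_sub_one ht.ne']; ring_nf
  rw [besselPair, besselP, besselP, this]
  ring

theorem continuous_besselPair {α : ℝ} (hα : 0 < α) (m n : ℕ) :
    Continuous (besselPair α m n) :=
  ((Real.continuous_rpow_const (by positivity)).mul ((continuous_wtCos (by positivity)).mul
    (continuous_wtCos (by positivity)))).div_const _

theorem integrableOn_besselPair {α : ℝ} (hα : 0 < α) (m n : ℕ) :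
    IntegrableOn (besselPair α m n) (Ioi 0) := by
  refine IntegrableOn.mono_set (t := Ici 0) ?_ Ioi_subset_Ici_self
  refine LocallyIntegrableOn.integrableOn_of_isBigO_atTop
    ((continuous_besselPair hα m n).locallyIntegrable.locallyIntegrableOn _)
    (g := fun t : ℝ => t ^ (-2 : ℝ)) ?_
    (integrableAtFilter_rpow_atTop_iff.2 (by norm_num))
  refine (((besselP_isBigO hα m).mul (besselP_isBigO hα n)).mul
    (isBigO_refl (fun t : ℝ => t⁻¹) atTop)).congr' ?_ ?_
  · filter_upwards [eventually_gt_atTop 0] with t ht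
    rw [besselPair_eq m n ht, div_eq_mul_inv]
  · filter_upwards [eventually_gt_atTop 0] with t ht
    rw [← Real.rpow_neg_one, ← Real.rpow_add ht, ← Real.rpow_add ht]; norm_num

/-- For orders `μ`, `ν` Bessel's equation gives `(t(f'g - fg'))' = (μ² - ν²) fg/t`; integrate over
the half-line. -/
theorem integral_besselPair_of_even {α : ℝ} (hα : 0 < α) (n k : ℕ) (hk : k ≠ 0) :
    ∫ t in Ioi (0 : ℝ), besselPair α (n + 2 * k) n t = 0 := by
  set m := n + 2 * k with hm
  set f := besselP α m with hf
  set g := besselP α n with hg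
  set f1 := besselP α (m + 1) with hf1
  set g1 := besselP α (n + 1) with hg1
  -- This is `t(f'g - fg')` with the derivatives eliminated by the recurrences, hence continuous at
  -- `0`.
  set W : ℝ → ℝ := fun t => ((m : ℝ) - n) * (f t * g t) - t * (f1 t * g t - f t * g1 t) with hW
  have hcf := continuous_besselP hα m
  have hcg := continuous_besselP hα n
  have hcf1 := continuous_besselP hα (m + 1)
  have hcg1 := continuous_besselP hα (n + 1)
  have hWc : Continuous W := by
    simp only [hW]; fun_prop
  have hWd : ∀ t ∈ Ioi (0 : ℝ), HasDerivAt W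
      (((m : ℝ) - n) * (m + n + 2 * α + 1) * besselPair α m n t) t := by
    intro t ht
    have ht0 : (0 : ℝ) < t := ht
    have a1 := hasDerivAt_besselP hα m ht0
    have a2 := hasDerivAt_besselP hα n ht0
    have a3 := hasDerivAt_besselP_succ hα m ht0
    have a4 := hasDerivAt_besselP_succ hα n ht0
    rw [← hf, ← hf1] at a1 a3
    rw [← hg, ← hg1] at a2 a4
    refine (((a1.mul a2).const_mul ((m : ℝ) - n)).sub ((hasDerivAt_id t).mul
      ((a3.mul a2).sub (a1.mul a4)))).congr_deriv ?_
    rw [besselPair_eq m n ht0, ← hf, ← hg]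
    simp only [id, Pi.sub_apply, Pi.mul_apply]
    field_simp
    ring
  -- As `f - (-1)^k g` and `f1 - (-1)^k g1` are `O(t^(-3/2))`, the leading terms of `f1 g - f g1`
  -- cancel, leaving `O(t^(-2))` against the factor `t`.
  have hlim : Tendsto W atTop (nhds 0) := by
    have r1 := besselP_add_two_mul_isBigO hα n k
    have r2 := besselP_add_two_mul_isBigO hα (n + 1) k
    rw [← hm] at r1
    rw [show n + 1 + 2 * k = m + 1 by omega] at r2
    have b1 := besselP_isBigO hα n
    have b2 := besselP_isBigO hα (n + 1)
    have c1 : (fun t => ((m : ℝ) - n) * (f t * g t)) =O[atTop] fun t : ℝ => t ^ (-1 : ℝ) := by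
      refine IsBigO.const_mul_left (((besselP_isBigO hα m).mul b1).congr' EventuallyEq.rfl ?_) _
      filter_upwards [eventually_gt_atTop 0] with t ht
      rw [← Real.rpow_add ht]; norm_num
    have c2 : (fun t => t * (f1 t * g t - f t * g1 t)) =O[atTop] fun t : ℝ => t ^ (-1 : ℝ) := by
      have d := (isBigO_refl (fun t : ℝ => t) atTop).mul ((r2.mul b1).sub
        ((r1.mul b2).congr' EventuallyEq.rfl EventuallyEq.rfl))
      refine d.congr' ?_ ?_
      · refine Eventually.of_forall fun t => ?_
        simp only [hf, hg, hf1, hg1]; ring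
      · filter_upwards [eventually_gt_atTop 0] with t ht
        rw [← Real.rpow_add ht]
        nth_rewrite 1 [← Real.rpow_one t]
        rw [← Real.rpow_add ht]; norm_num
    exact (c1.sub c2).trans_tendsto (tendsto_rpow_neg_atTop one_pos)
  have hint := ((integrableOn_besselPair hα m n).const_mul
    (((m : ℝ) - n) * (m + n + 2 * α + 1)))
  have h := integral_Ioi_of_hasDerivAt_of_tendsto hWc.continuousWithinAt hWd hint hlim
  rw [integral_const_mul] at h
  have hW0 : W 0 = 0 := by
    simp [hW, hf, hg, besselP_zero hα]
  rw [hW0, sub_zero] at h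
  refine (mul_eq_zero.1 h).resolve_left (mul_pos ?_ (by positivity)).ne'
  have : 0 < k := Nat.pos_of_ne_zero hk
  have : (0 : ℝ) < k := by exact_mod_cast this
  rw [hm]; push_cast; linarith

/-- The derivative of `J_ν² + J_{ν+1}²` is `(2ν J_ν² - 2(ν+1) J_{ν+1}²)/t`, and the function
vanishes at `0` and at infinity. -/
theorem integral_besselPair_self_succ {α : ℝ} (hα : 0 < α) (n : ℕ) :
    (2 * (n + 1 : ℕ) + 2 * α + 1) * ∫ t in Ioi (0 : ℝ), besselPair α (n + 1) (n + 1) t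
      = (2 * n + 2 * α + 1) * ∫ t in Ioi (0 : ℝ), besselPair α n n t := by
  set f := besselP α n with hf
  set h := besselP α (n + 1) with hh
  have hd : ∀ t ∈ Ioi (0 : ℝ), HasDerivAt (fun t => f t ^ 2 + h t ^ 2)
      ((2 * n + 2 * α + 1) * besselPair α n n t
        - (2 * (n + 1 : ℕ) + 2 * α + 1) * besselPair α (n + 1) (n + 1) t) t := by
    intro t ht
    have ht0 : (0 : ℝ) < t := ht
    have h1 := hasDerivAt_besselP hα n ht0
    have h2 := hasDerivAt_besselP_succ hα n ht0
    rw [← hf, ← hh] at h1 h2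
    refine ((h1.pow 2).add (h2.pow 2)).congr_deriv ?_
    rw [besselPair_eq _ _ ht0, besselPair_eq _ _ ht0, ← hf, ← hh]
    push_cast
    field_simp
    ring
  have hlim : Tendsto (fun t => f t ^ 2 + h t ^ 2) atTop (nhds 0) := by
    have z : Tendsto (fun t : ℝ => t ^ (-(1 / 2) : ℝ)) atTop (nhds 0) :=
      tendsto_rpow_neg_atTop (by norm_num)
    have z1 := ((besselP_isBigO hα n).trans_tendsto z).pow 2
    have z2 := ((besselP_isBigO hα (n + 1)).trans_tendsto z).pow 2
    simpa using z1.add z2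
  have i1 := (integrableOn_besselPair hα n n).const_mul (2 * n + 2 * α + 1)
  have i2 := (integrableOn_besselPair hα (n + 1) (n + 1)).const_mul
    (2 * (n + 1 : ℕ) + 2 * α + 1)
  have e := integral_Ioi_of_hasDerivAt_of_tendsto
    (((continuous_besselP hα n).pow 2).add
      ((continuous_besselP hα (n + 1)).pow 2)).continuousWithinAt hd (i1.sub i2) hlim
  rw [integral_sub i1 i2, integral_const_mul, integral_const_mul] at e
  have z1 : f 0 = 0 := besselP_zero hα n
  have z2 : h 0 = 0 := besselP_zero hα (n + 1)
  have e0 : f 0 ^ 2 + h 0 ^ 2 = 0 := by rw [z1, z2]; norm_num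
  change _ = 0 - (f 0 ^ 2 + h 0 ^ 2) at e
  rw [e0] at e
  linarith

theorem integral_besselPair_self {α : ℝ} (hα : 0 < α) (n : ℕ) :
    (2 * n + 2 * α + 1) * ∫ t in Ioi (0 : ℝ), besselPair α n n t
      = (2 * α + 1) * ∫ t in Ioi (0 : ℝ), besselPair α 0 0 t := by
  induction n with
  | zero => simp
  | succ n ih => rw [integral_besselPair_self_succ hα, ih]

theorem integral_besselPair_zero_pos {α : ℝ} (hα : 0 < α) :
    0 < ∫ t in Ioi (0 : ℝ), besselPair α 0 0 t := by
  have hG := Real.Gamma_pos_of_pos (show 0 < α + 1 by linarith)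
  have hpos : 0 < ∫ t in (0 : ℝ)..1, besselPair α 0 0 t := by
    refine intervalIntegral.intervalIntegral_pos_of_pos_on
      ((continuous_besselPair hα 0 0).intervalIntegrable _ _) (fun t ht => ?_) one_pos
    have h1 := wtCos_pos hα.le (Ioo_subset_Icc_self ht)
    have h2 : 0 < t ^ (2 * α) := Real.rpow_pos_of_pos ht.1 _
    simp only [besselPair, Nat.cast_zero, zero_add, pow_zero, one_mul]
    positivity
  rw [intervalIntegral.integral_of_le zero_le_one] at hpos
  refine hpos.trans_le (setIntegral_mono_set (integrableOn_besselPair hα 0 0) ?_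
    (Ioc_subset_Ioi_self.eventuallyLE))
  refine (ae_restrict_iff' measurableSet_Ioi).2 (Eventually.of_forall fun t ht => ?_)
  have ht0 : (0 : ℝ) < t := ht
  rw [besselPair_eq _ _ ht0]
  exact div_nonneg (mul_self_nonneg _) ht0.le

/-! ### Fourier transform of the basis functions and the stiffness matrix. -/

/-- The Fourier transform (at angular frequency `ω`) of `(1 - x²)^g P_k^{g,g}` on `(-1, 1)`. -/
def jacobiFourier (g : ℝ) (k : ℕ) (ω : ℝ) : ℂ :=
  ∫ x in (-1 : ℝ)..1, Complex.exp (-(Complex.I * ω * x)) * ((wt g x * jacobiP g g k x : ℝ) : ℂ)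

theorem continuous_ofReal_wt_mul_jacobiP {g : ℝ} (hg : 0 ≤ g) (k : ℕ) :
    Continuous fun x => ((wt g x * jacobiP g g k x : ℝ) : ℂ) :=
  Complex.continuous_ofReal.comp ((continuous_wt hg).mul (continuous_jacobiP g k))

theorem jacobiFourier_succ {g : ℝ} (hg : 0 ≤ g) (k : ℕ) (ω : ℝ) :
    jacobiFourier g (k + 1) ω
      = -(Complex.I * ω / 2) / ((k : ℂ) + 1) * jacobiFourier (g + 1) k ω := by
  have he : ∀ x : ℝ, HasDerivAt (fun x : ℝ => Complex.exp (-(Complex.I * ω * x)))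
      (-(Complex.I * ω) * Complex.exp (-(Complex.I * ω * x))) x := fun x => by
    have h1 : HasDerivAt (fun x : ℝ => (x : ℂ)) 1 x := Complex.ofRealCLM.hasDerivAt
    refine ((h1.const_mul (Complex.I * ω)).fun_neg.cexp).congr_deriv ?_
    ring
  have hp : ∀ x : ℝ, HasDerivAt
      (fun x : ℝ => ((wt (g + 1) x * jacobiP (g + 1) (g + 1) k x : ℝ) : ℂ))
      (((-2 * (k + 1) * (wt g x * jacobiP g g (k + 1) x) : ℝ) : ℂ)) x :=
    fun x => (hasDerivAt_wt_mul_jacobiP g hg k x).ofReal_comp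
  have h := intervalIntegral.integral_mul_deriv_eq_deriv_mul (a := (-1 : ℝ)) (b := 1)
    (fun x _ => he x) (fun x _ => hp x)
    ((by fun_prop : Continuous fun x : ℝ =>
      -(Complex.I * ω) * Complex.exp (-(Complex.I * ω * x))).intervalIntegrable _ _)
    ((Complex.continuous_ofReal.comp (continuous_const.mul
      ((continuous_wt hg).mul (continuous_jacobiP g (k + 1))))).intervalIntegrable _ _)
  rw [wt_apply_one (by linarith), wt_apply_neg_one (by linarith)] at h
  have e1 : ∀ x : ℝ, Complex.exp (-(Complex.I * ω * x)) *
      ((-2 * (k + 1) * (wt g x * jacobiP g g (k + 1) x) : ℝ) : ℂ)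
      = (-2 * ((k : ℂ) + 1)) * (Complex.exp (-(Complex.I * ω * x)) *
        ((wt g x * jacobiP g g (k + 1) x : ℝ) : ℂ)) := fun x => by push_cast; ring
  have e2 : ∀ x : ℝ, -(Complex.I * ω) * Complex.exp (-(Complex.I * ω * x)) *
      ((wt (g + 1) x * jacobiP (g + 1) (g + 1) k x : ℝ) : ℂ)
      = -(Complex.I * ω) * (Complex.exp (-(Complex.I * ω * x)) *
        ((wt (g + 1) x * jacobiP (g + 1) (g + 1) k x : ℝ) : ℂ)) := fun x => by ring
  simp only [e1, e2, intervalIntegral.integral_const_mul, zero_mul, Complex.ofReal_zero,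
    mul_zero, sub_zero, zero_sub] at h
  have hk : (k : ℂ) + 1 ≠ 0 := Nat.cast_add_one_ne_zero k
  change (-2 * ((k : ℂ) + 1)) * jacobiFourier g (k + 1) ω
    = -(-(Complex.I * ω) * jacobiFourier (g + 1) k ω) at h
  rw [div_mul_eq_mul_div, eq_div_iff hk]
  linear_combination (-1 / 2 : ℂ) * h

/-- The sine part is odd and integrates to zero. -/
theorem jacobiFourier_zero {g : ℝ} (hg : 0 ≤ g) (ω : ℝ) :
    jacobiFourier g 0 ω = (wtCos g ω : ℂ) := by
  have hw := continuous_wt hg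
  have hs : ∫ x in (-1 : ℝ)..1, wt g x * Real.sin (ω * x) = 0 := by
    have h := intervalIntegral.integral_comp_neg (a := (-1 : ℝ)) (b := 1)
      (fun x => wt g x * Real.sin (ω * x))
    have e : ∀ x, wt g (-x) * Real.sin (ω * -x) = -(wt g x * Real.sin (ω * x)) := fun x => by
      simp [wt]
    simp only [e, intervalIntegral.integral_neg, neg_neg] at h
    linarith
  have e : ∀ x : ℝ, Complex.exp (-(Complex.I * ω * x)) * ((wt g x * jacobiP g g 0 x : ℝ) : ℂ)
      = ((wt g x * Real.cos (ω * x) : ℝ) : ℂ)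
        - Complex.I * ((wt g x * Real.sin (ω * x) : ℝ) : ℂ) := fun x => by
    rw [jacobiP_zero, show -(Complex.I * ω * x) = (-((ω : ℂ) * x)) * Complex.I by ring,
      Complex.exp_mul_I, Complex.cos_neg, Complex.sin_neg]
    push_cast; ring
  have i1 : Continuous fun x : ℝ => ((wt g x * Real.cos (ω * x) : ℝ) : ℂ) :=
    Complex.continuous_ofReal.comp (by fun_prop)
  have i2 : Continuous fun x : ℝ => Complex.I * ((wt g x * Real.sin (ω * x) : ℝ) : ℂ) :=
    continuous_const.mul (Complex.continuous_ofReal.comp (by fun_prop))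
  simp only [jacobiFourier, e]
  rw [intervalIntegral.integral_sub (i1.intervalIntegrable _ _) (i2.intervalIntegrable _ _),
    intervalIntegral.integral_const_mul, intervalIntegral.integral_ofReal,
    intervalIntegral.integral_ofReal, hs]
  simp [wtCos]

theorem jacobiFourier_eq {g : ℝ} (hg : 0 ≤ g) (n : ℕ) (ω : ℝ) :
    jacobiFourier g n ω
      = (-(Complex.I * ω / 2)) ^ n / (n.factorial : ℂ) * (wtCos (n + g) ω : ℂ) := by
  induction n generalizing g with
  | zero => simp [jacobiFourier_zero hg]
  | succ n ih =>
    rw [jacobiFourier_succ hg, ih (by linarith : 0 ≤ g + 1), Nat.factorial_succ]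
    have : (n : ℝ) + (g + 1) = ((n + 1 : ℕ) : ℝ) + g := by push_cast; ring
    rw [this, pow_succ]
    have hk : (n : ℂ) + 1 ≠ 0 := Nat.cast_add_one_ne_zero n
    have hf : (n.factorial : ℂ) ≠ 0 := by exact_mod_cast n.factorial_ne_zero
    push_cast
    field_simp

theorem basisFun_eq_indicator (α : ℝ) (n : ℕ) :
    basisFun α n = (Ioo (-1 : ℝ) 1).indicator fun x =>
      (basisConst α n : ℂ) * ((wt α x * jacobiP α α n x : ℝ) : ℂ) := by
  ext x
  simp only [basisFun, genJacobi, Pi.smul_apply, smul_eq_mul, basisConst]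
  by_cases hx : x ∈ Ioo (-1 : ℝ) 1
  · rw [indicator_of_mem hx, indicator_of_mem hx, wt]
  · rw [indicator_of_notMem hx, indicator_of_notMem hx, mul_zero]

theorem zeroExt_basisFun (α : ℝ) (n : ℕ) : zeroExt (basisFun α n) = basisFun α n := by
  rw [zeroExt, basisFun_eq_indicator, indicator_indicator, inter_self]

theorem integrable_basisFun {α : ℝ} (hα : 0 < α) (n : ℕ) : Integrable (basisFun α n) := by
  rw [basisFun_eq_indicator, integrable_indicator_iff measurableSet_Ioo]
  exact ((continuous_const.mul
    (continuous_ofReal_wt_mul_jacobiP hα.le n)).integrableOn_Icc).mono_set Ioo_subset_Icc_self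

theorem fourier_basisFun {α : ℝ} (n : ℕ) (ξ : ℝ) :
    𝓕 (basisFun α n) ξ = (basisConst α n : ℂ) * jacobiFourier α n (2 * Real.pi * ξ) := by
  rw [Real.fourier_real_eq_integral_exp_smul, basisFun_eq_indicator, jacobiFourier,
    ← intervalIntegral.integral_const_mul, intervalIntegral.integral_of_le (by norm_num),
    integral_Ioc_eq_integral_Ioo, ← integral_indicator measurableSet_Ioo]
  congr 1
  ext x
  by_cases hx : x ∈ Ioo (-1 : ℝ) 1
  · rw [indicator_of_mem hx, indicator_of_mem hx, smul_eq_mul]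
    have : ((-2 * Real.pi * x * ξ : ℝ) : ℂ) * Complex.I
        = -(Complex.I * ((2 * Real.pi * ξ : ℝ) : ℂ) * x) := by push_cast; ring
    rw [this]; ring
  · rw [indicator_of_notMem hx, indicator_of_notMem hx, smul_zero]

/-- The real profile of the Fourier side of the Riesz derivative of `φ_n`. -/
def symbolProfile (α : ℝ) (n : ℕ) (ω : ℝ) : ℝ :=
  |ω| ^ α * (basisConst α n * (ω / 2) ^ n / n.factorial * wtCos (n + α) ω)

theorem rieszSymbolMul_basisFun {α : ℝ} (hα : 0 < α) (n : ℕ) (ξ : ℝ) :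
    rieszSymbolMul α (basisFun α n) ξ = (-1 : ℂ) ^ ⌊(α + 1) / 2⌋ * (-Complex.I) ^ n
      * (symbolProfile α n (2 * Real.pi * ξ) : ℂ) := by
  rw [rieszSymbolMul, zeroExt_basisFun, fourier_basisFun, jacobiFourier_eq hα.le, symbolProfile]
  rw [show -(Complex.I * ((2 * Real.pi * ξ : ℝ) : ℂ) / 2)
    = (-Complex.I) * (((2 * Real.pi * ξ : ℝ) : ℂ) / 2) by ring, mul_pow (-Complex.I)]
  push_cast
  ring

theorem continuous_symbolProfile {α : ℝ} (hα : 0 < α) (n : ℕ) :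
    Continuous (symbolProfile α n) := by
  have h1 := continuous_wtCos (show (0 : ℝ) ≤ n + α by positivity)
  have h2 : Continuous fun ω : ℝ => |ω| ^ α :=
    continuous_abs.rpow_const fun _ => Or.inr hα.le
  unfold symbolProfile
  fun_prop

theorem symbolProfile_neg (α : ℝ) (n : ℕ) (ω : ℝ) :
    symbolProfile α n (-ω) = (-1) ^ n * symbolProfile α n ω := by
  rw [symbolProfile, symbolProfile, abs_neg, wtCos_neg, neg_div, neg_pow (ω / 2)]; ring

theorem basisConst_div {α : ℝ} (hα : 0 < α) (n : ℕ) :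
    basisConst α n / (2 ^ n * n.factorial) = Real.sqrt (2 * n + 2 * α + 1)
      / ((2 : ℝ) ^ (α + 1 / 2)) * (2 ^ n * Real.Gamma (n + α + 1))⁻¹ := by
  have := Real.Gamma_pos_of_pos (show (0 : ℝ) < n + α + 1 by positivity)
  have := Nat.factorial_ne_zero n
  have : (0 : ℝ) < 2 ^ (α + 1 / 2) := by positivity
  rw [basisConst]
  field_simp

theorem symbolProfile_mul {α : ℝ} (hα : 0 < α) {m n : ℕ} (hmn : Even (m + n)) (ω : ℝ) :
    symbolProfile α m ω * symbolProfile α n ω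
      = Real.sqrt (2 * m + 2 * α + 1) * Real.sqrt (2 * n + 2 * α + 1)
        / ((2 : ℝ) ^ (α + 1 / 2)) ^ 2 * besselPair α m n |ω| := by
  -- Evenness of `m + n` is used to replace `ω^(m+n)` by `|ω|^(m+n)`.
  have h1 : |ω| ^ ((m : ℝ) + n + 2 * α) = |ω| ^ α * |ω| ^ α * (ω ^ m * ω ^ n) := by
    rw [← pow_add, ← hmn.pow_abs, ← Real.rpow_natCast |ω| (m + n),
      ← Real.rpow_add_of_nonneg (abs_nonneg _) hα.le hα.le,
      ← Real.rpow_add_of_nonneg (abs_nonneg _) (by positivity) (by positivity)]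
    congr 1; push_cast; ring
  have h2 : ∀ g, wtCos g |ω| = wtCos g ω := fun g => by
    rcases abs_choice ω with h | h <;> rw [h]
    exact wtCos_neg g ω
  have h3 : ∀ k : ℕ, symbolProfile α k ω = |ω| ^ α * ω ^ k * wtCos (k + α) ω *
      (basisConst α k / (2 ^ k * k.factorial)) := fun k => by
    rw [symbolProfile, div_pow]
    have := Nat.factorial_ne_zero k
    field_simp
  rw [h3, h3, basisConst_div hα, basisConst_div hα, besselPair, h1, h2, h2, mul_inv_rev,
    mul_inv_rev]
  field_simp

theorem integrable_besselPair_abs {α : ℝ} (hα : 0 < α) (m n : ℕ) :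
    Integrable fun ω : ℝ => besselPair α m n |ω| := by
  have h := (integrable_fun_norm_addHaar (E := ℝ) (F := ℝ) volume (f := besselPair α m n)).2
    (by simpa using integrableOn_besselPair hα m n)
  simpa [Real.norm_eq_abs] using h

theorem memLp_symbolProfile {α : ℝ} (hα : 0 < α) (n : ℕ) :
    MemLp (fun ξ : ℝ => symbolProfile α n (2 * Real.pi * ξ)) 2 := by
  have hc : Continuous fun ξ : ℝ => symbolProfile α n (2 * Real.pi * ξ) :=
    (continuous_symbolProfile hα n).comp (continuous_const.mul continuous_id)
  rw [memLp_two_iff_integrable_sq_norm hc.aestronglyMeasurable]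
  have h := ((integrable_besselPair_abs hα n n).const_mul
    (Real.sqrt (2 * n + 2 * α + 1) * Real.sqrt (2 * n + 2 * α + 1)
        / ((2 : ℝ) ^ (α + 1 / 2)) ^ 2)).comp_mul_left' (R := 2 * Real.pi) (by positivity)
  refine h.congr (Eventually.of_forall fun ξ => ?_)
  simp only
  rw [← symbolProfile_mul hα (Even.add_self n), Real.norm_eq_abs, sq_abs, sq]

/-- The common diagonal value of the stiffness matrix. -/
def stiffConst (α : ℝ) : ℝ :=
  (2 * α + 1) / ((2 : ℝ) ^ (α + 1 / 2)) ^ 2 / Real.pi * ∫ t in Ioi (0 : ℝ), besselPair α 0 0 t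

theorem stiffConst_pos {α : ℝ} (hα : 0 < α) : 0 < stiffConst α := by
  have := integral_besselPair_zero_pos hα
  have := Real.pi_pos
  unfold stiffConst
  positivity

/-- The factor `1/π` is `2/(2π)`: the substitution `ω = 2πξ`, and twice the half-line integral. -/
theorem integral_symbolProfile_mul_of_even {α : ℝ} (hα : 0 < α) {m n : ℕ} (hmn : Even (m + n)) :
    ∫ ξ : ℝ, symbolProfile α m (2 * Real.pi * ξ) * symbolProfile α n (2 * Real.pi * ξ)
      = Real.sqrt (2 * m + 2 * α + 1) * Real.sqrt (2 * n + 2 * α + 1)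
        / ((2 : ℝ) ^ (α + 1 / 2)) ^ 2 / Real.pi * ∫ t in Ioi (0 : ℝ), besselPair α m n t := by
  have h := Measure.integral_comp_mul_left
    (fun ω => symbolProfile α m ω * symbolProfile α n ω) (2 * Real.pi)
  rw [h]
  simp only [symbolProfile_mul hα hmn]
  rw [integral_const_mul, integral_comp_abs (f := besselPair α m n), smul_eq_mul,
    abs_of_pos (by positivity)]
  field_simp

theorem besselPair_comm (α : ℝ) (m n : ℕ) : besselPair α m n = besselPair α n m := by
  ext t; rw [besselPair, besselPair, add_comm (m : ℝ) n, mul_comm (wtCos _ _),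
    mul_comm (2 ^ m * _)]

/-- Equal parity reduces to Bessel orthogonality; for opposite parity the integrand is odd. -/
theorem integral_symbolProfile_mul_of_ne {α : ℝ} (hα : 0 < α) {m n : ℕ} (hmn : m ≠ n) :
    ∫ ξ : ℝ, symbolProfile α m (2 * Real.pi * ξ) * symbolProfile α n (2 * Real.pi * ξ) = 0 := by
  rcases Nat.even_or_odd (m + n) with h | h
  · rw [integral_symbolProfile_mul_of_even hα h]
    have : ∫ t in Ioi (0 : ℝ), besselPair α m n t = 0 := by
      rcases lt_or_gt_of_ne hmn with hlt | hlt
      · obtain ⟨k, hk⟩ : ∃ k, n = m + 2 * k := by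
          obtain ⟨r, hr⟩ := h
          exact ⟨r - m, by omega⟩
        rw [besselPair_comm, hk]
        exact integral_besselPair_of_even hα m k (by omega)
      · obtain ⟨k, hk⟩ : ∃ k, m = n + 2 * k := by
          obtain ⟨r, hr⟩ := h
          exact ⟨r - n, by omega⟩
        rw [hk]
        exact integral_besselPair_of_even hα n k (by omega)
    rw [this, mul_zero]
  · have e := integral_neg_eq_self
      (fun ξ : ℝ => symbolProfile α m (2 * Real.pi * ξ) * symbolProfile α n (2 * Real.pi * ξ))
      volume
    have e1 : ∀ ξ : ℝ, symbolProfile α m (2 * Real.pi * -ξ) *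
        symbolProfile α n (2 * Real.pi * -ξ)
        = -(symbolProfile α m (2 * Real.pi * ξ) * symbolProfile α n (2 * Real.pi * ξ)) := by
      intro ξ
      rw [mul_neg, symbolProfile_neg, symbolProfile_neg]
      have := h.neg_one_pow (α := ℝ)
      rw [pow_add] at this
      linear_combination (symbolProfile α m (2 * Real.pi * ξ) *
        symbolProfile α n (2 * Real.pi * ξ)) * this
    simp only [e1, integral_neg] at e
    linarith

theorem integral_symbolProfile_mul_self {α : ℝ} (hα : 0 < α) (n : ℕ) :
    ∫ ξ : ℝ, symbolProfile α n (2 * Real.pi * ξ) * symbolProfile α n (2 * Real.pi * ξ)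
      = stiffConst α := by
  rw [integral_symbolProfile_mul_of_even hα (Even.add_self n),
    Real.mul_self_sqrt (by positivity), stiffConst]
  have := integral_besselPair_self hα n
  linear_combination (1 / ((2 : ℝ) ^ (α + 1 / 2)) ^ 2 / Real.pi) * this

theorem memLp_rieszSymbolMul_basisFun {α : ℝ} (hα : 0 < α) (n : ℕ) :
    MemLp (rieszSymbolMul α (basisFun α n)) 2 := by
  rw [funext (rieszSymbolMul_basisFun hα n)]
  exact ((memLp_symbolProfile hα n).ofReal (K := ℂ)).const_mul _

theorem rieszSymbolMul_sum {ι : Type*} [Fintype ι] (s : ℝ) (f : ι → ℝ → ℂ) (z : ι → ℂ)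
    (hf : ∀ i, Integrable (f i)) (ξ : ℝ) :
    rieszSymbolMul s (∑ i, z i • f i) ξ = ∑ i, z i * rieszSymbolMul s (f i) ξ := by
  have h0 : zeroExt (∑ i, z i • f i) = ∑ i, z i • zeroExt (f i) := by
    ext x
    by_cases hx : x ∈ Ioo (-1 : ℝ) 1 <;> simp [zeroExt, hx]
  have h : 𝓕 (zeroExt (∑ i, z i • f i)) ξ = ∑ i, z i * 𝓕 (zeroExt (f i)) ξ := by
    simp only [Real.fourier_real_eq_integral_exp_smul]
    rw [h0]
    have e : ∀ v : ℝ, Complex.exp (((-2 * Real.pi * v * ξ : ℝ) : ℂ) * Complex.I) •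
        (∑ i, z i • zeroExt (f i)) v
        = ∑ i, z i * (Complex.exp (((-2 * Real.pi * v * ξ : ℝ) : ℂ) * Complex.I) •
          zeroExt (f i) v) := fun v => by
      simp only [Finset.sum_apply, Pi.smul_apply, smul_eq_mul, Finset.mul_sum]
      exact Finset.sum_congr rfl fun i _ => by ring
    simp only [e]
    rw [integral_finsetSum]
    · exact Finset.sum_congr rfl fun i _ => integral_const_mul _ _
    · intro i _
      refine Integrable.const_mul ?_ _
      have hz : Integrable (zeroExt (f i)) := (hf i).indicator measurableSet_Ioo
      refine hz.bdd_mul (c := 1) (Continuous.aestronglyMeasurable (by fun_prop))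
        (Eventually.of_forall fun v => ?_)
      rw [Complex.norm_exp_ofReal_mul_I]
  simp only [rieszSymbolMul, h, Finset.mul_sum]
  exact Finset.sum_congr rfl fun i _ => by ring

/-- Plancherel in `L²`. -/
theorem formA_eq_integral {α : ℝ} {u v : ℝ → ℂ} (hu : MemLp (rieszSymbolMul α u) 2)
    (hv : MemLp (rieszSymbolMul α v) 2) :
    formA α u v = ∫ ξ, rieszSymbolMul α u ξ * conj (rieszSymbolMul α v ξ) := by
  have h1 : formA α u v = inner ℂ (rieszDeriv α v) (rieszDeriv α u) := by
    rw [L2.inner_def]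
    rfl
  have hu' : rieszDeriv α u = 𝓕⁻ (hu.toLp (rieszSymbolMul α u)) := by
    rw [rieszDeriv, dif_pos hu]
  have hv' : rieszDeriv α v = 𝓕⁻ (hv.toLp (rieszSymbolMul α v)) := by
    rw [rieszDeriv, dif_pos hv]
  rw [h1, hu', hv', ← Lp.inner_fourier_eq, FourierInvPair.fourier_fourierInv_eq,
    FourierInvPair.fourier_fourierInv_eq, L2.inner_def]
  refine integral_congr_ae ?_
  filter_upwards [hu.coeFn_toLp, hv.coeFn_toLp] with ξ h2 h3
  rw [h2, h3]
  rfl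

theorem integral_rieszSymbolMul_basisFun {α : ℝ} (hα : 0 < α) (m n : ℕ) :
    ∫ ξ, rieszSymbolMul α (basisFun α m) ξ * conj (rieszSymbolMul α (basisFun α n) ξ)
      = if m = n then (stiffConst α : ℂ) else 0 := by
  have hs : (-1 : ℂ) ^ ⌊(α + 1) / 2⌋ * conj ((-1 : ℂ) ^ ⌊(α + 1) / 2⌋) = 1 := by
    rw [Complex.mul_conj, Complex.normSq_eq_norm_sq]; simp
  have e : ∀ ξ, rieszSymbolMul α (basisFun α m) ξ * conj (rieszSymbolMul α (basisFun α n) ξ)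
      = ((-Complex.I) ^ m * Complex.I ^ n) * ((symbolProfile α m (2 * Real.pi * ξ) *
        symbolProfile α n (2 * Real.pi * ξ) : ℝ) : ℂ) := fun ξ => by
    rw [rieszSymbolMul_basisFun hα, rieszSymbolMul_basisFun hα]
    simp only [map_mul, map_pow, map_neg, Complex.conj_I, neg_neg, Complex.conj_ofReal]
    push_cast
    linear_combination ((-Complex.I) ^ m * Complex.I ^ n *
      (symbolProfile α m (2 * Real.pi * ξ) * symbolProfile α n (2 * Real.pi * ξ))) * hs
  simp only [e]
  rw [integral_const_mul, integral_complex_ofReal]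
  split_ifs with h
  · subst h
    rw [integral_symbolProfile_mul_self hα, ← mul_pow]
    simp
  · rw [integral_symbolProfile_mul_of_ne hα h]; simp

theorem memLp_rieszSymbolMul_sum {α : ℝ} (hα : 0 < α) (N : ℕ) (z : Fin (N + 1) → ℂ) :
    MemLp (rieszSymbolMul α (∑ i, z i • basisFun α i)) 2 := by
  rw [funext (rieszSymbolMul_sum α (fun i : Fin (N + 1) => basisFun α i) z
    fun i => integrable_basisFun hα i)]
  exact memLp_finsetSum _ fun i _ => (memLp_rieszSymbolMul_basisFun hα i).const_mul _

/-- The basis functions are orthogonal for `a`, with constant diagonal. -/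
theorem formA_sum {α : ℝ} (hα : 0 < α) (N : ℕ) (z w : Fin (N + 1) → ℂ) :
    formA α (∑ i, z i • basisFun α i) (∑ i, w i • basisFun α i)
      = stiffConst α * ∑ i, z i * conj (w i) := by
  rw [formA_eq_integral (memLp_rieszSymbolMul_sum hα N z) (memLp_rieszSymbolMul_sum hα N w)]
  have e : ∀ ξ, rieszSymbolMul α (∑ i, z i • basisFun α i) ξ *
      conj (rieszSymbolMul α (∑ i, w i • basisFun α i) ξ)
      = ∑ i : Fin (N + 1), ∑ j : Fin (N + 1), z i * conj (w j) *
        (rieszSymbolMul α (basisFun α i) ξ * conj (rieszSymbolMul α (basisFun α j) ξ)) := by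
    intro ξ
    rw [rieszSymbolMul_sum α (fun i : Fin (N + 1) => basisFun α i) z
      (fun i => integrable_basisFun hα i),
      rieszSymbolMul_sum α (fun i : Fin (N + 1) => basisFun α i) w
      (fun i => integrable_basisFun hα i), map_sum, Finset.sum_mul_sum]
    refine Finset.sum_congr rfl fun i _ => Finset.sum_congr rfl fun j _ => ?_
    rw [map_mul]; ring
  have hint : ∀ i j : Fin (N + 1), Integrable fun ξ => z i * conj (w j) *
        (rieszSymbolMul α (basisFun α i) ξ * conj (rieszSymbolMul α (basisFun α j) ξ)) :=
    fun i j => ((memLp_rieszSymbolMul_basisFun hα i).integrable_mul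
      (memLp_rieszSymbolMul_basisFun hα j).star).const_mul _
  simp only [e]
  rw [integral_finsetSum _ fun i _ => integrable_finsetSum _ fun j _ => hint i j, Finset.mul_sum]
  refine Finset.sum_congr rfl fun i _ => ?_
  rw [integral_finsetSum _ fun j _ => hint i j, Finset.sum_eq_single i]
  · rw [integral_const_mul, integral_rieszSymbolMul_basisFun hα, if_pos rfl]; ring
  · intro j _ hj
    rw [integral_const_mul, integral_rieszSymbolMul_basisFun hα,
      if_neg fun h => hj (Fin.ext h).symm, mul_zero]
  · exact fun h => absurd (Finset.mem_univ i) h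

/-! ### Extreme eigenvalues and condition number of a positive definite matrix. -/

open scoped Matrix in
/-- The extreme eigenvalues of a positive definite matrix: Rayleigh bounds, and the spectral
condition number. -/
theorem Matrix.IsHermitian.exists_extreme_eigenvalues {n : ℕ} [NeZero n]
    {M : Matrix (Fin n) (Fin n) ℂ} (hM : M.IsHermitian)
    (hpos : ∀ z : Fin n → ℂ, z ≠ 0 → 0 < (star z ⬝ᵥ M *ᵥ z).re) :
    ∃ a b : ℝ, 0 < a ∧ 0 < b ∧ IsUnit M ∧ spectralCond M = b / a ∧
      (∃ z : Fin n → ℂ, z ≠ 0 ∧ M *ᵥ z = (a : ℂ) • z) ∧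
      (∃ z : Fin n → ℂ, z ≠ 0 ∧ M *ᵥ z = (b : ℂ) • z) ∧
      ∀ z : Fin n → ℂ, a * (star z ⬝ᵥ z).re ≤ (star z ⬝ᵥ M *ᵥ z).re ∧
        (star z ⬝ᵥ M *ᵥ z).re ≤ b * (star z ⬝ᵥ z).re := by
  set ev := hM.eigenvalues with hev
  obtain ⟨i0, hi0⟩ := Finite.exists_min ev
  obtain ⟨i1, hi1⟩ := Finite.exists_max ev
  have hvne : ∀ i, (⇑(hM.eigenvectorBasis i) : Fin n → ℂ) ≠ 0 := fun i h => by
    have h1 := hM.eigenvectorBasis.orthonormal.ne_zero i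
    exact h1 (PiLp.ext fun j => congrFun h j)
  have hevpos : ∀ i, 0 < ev i := fun i => by
    rw [hev, hM.eigenvalues_eq i]
    exact hpos _ (hvne i)
  set U : Matrix (Fin n) (Fin n) ℂ := hM.eigenvectorUnitary.1 with hU
  set D : Matrix (Fin n) (Fin n) ℂ := Matrix.diagonal (RCLike.ofReal ∘ ev) with hD
  set E : Matrix (Fin n) (Fin n) ℂ := Matrix.diagonal fun i => ((ev i)⁻¹ : ℂ) with hE
  have hUU : U * star U = 1 := Unitary.coe_mul_star_self _
  have hUU' : star U * U = 1 := Unitary.coe_star_mul_self _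
  have hMU : M = U * D * star U := by
    conv_lhs => rw [hM.spectral_theorem, Unitary.conjStarAlgAut_apply]
  have hDE : D * E = 1 := by
    rw [hD, hE, Matrix.diagonal_mul_diagonal, ← Matrix.diagonal_one]
    congr 1
    ext i
    have : (ev i : ℂ) ≠ 0 := by exact_mod_cast (hevpos i).ne'
    exact mul_inv_cancel₀ this
  have hinv : M * (U * E * star U) = 1 := by
    calc M * (U * E * star U) = U * (D * ((star U * U) * E)) * star U := by
          rw [hMU]; simp only [Matrix.mul_assoc]
      _ = 1 := by rw [hUU', Matrix.one_mul, hDE, Matrix.mul_one, hUU]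
  have hunit : IsUnit M := IsUnit.of_mul_eq_one _ hinv
  -- The operator norm is unitarily invariant, so both `M` and its inverse have the norm of their
  -- diagonal factor.
  have hnorm : ∀ v : Fin n → ℂ, ‖Matrix.toEuclideanCLM (𝕜 := ℂ) (U * Matrix.diagonal v * star U)‖
      = ‖v‖ := by
    open scoped Matrix.Norms.L2Operator in
    intro v
    rw [Matrix.l2_opNorm_toEuclideanCLM, hU, ← Unitary.coe_star,
      CStarRing.norm_mul_coe_unitary, CStarRing.norm_coe_unitary_mul, Matrix.l2_opNorm_diagonal]
  have hn1 : ‖(RCLike.ofReal ∘ ev : Fin n → ℂ)‖ = ev i1 := by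
    refine le_antisymm ((pi_norm_le_iff_of_nonneg (hevpos i1).le).2 fun i => ?_) ?_
    · simpa [abs_of_pos (hevpos i)] using hi1 i
    · have := norm_le_pi_norm (RCLike.ofReal ∘ ev : Fin n → ℂ) i1
      simpa [abs_of_pos (hevpos i1)] using this
  have hn2 : ‖(fun i => ((ev i)⁻¹ : ℂ))‖ = (ev i0)⁻¹ := by
    refine le_antisymm ((pi_norm_le_iff_of_nonneg (inv_pos.2 (hevpos i0)).le).2 fun i => ?_) ?_
    · simpa [abs_of_pos (hevpos i)] using inv_anti₀ (hevpos i0) (hi0 i)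
    · have := norm_le_pi_norm (fun i => ((ev i)⁻¹ : ℂ)) i0
      simpa [abs_of_pos (hevpos i0)] using this
  refine ⟨ev i0, ev i1, hevpos i0, hevpos i1, hunit, ?_, ⟨_, hvne i0, ?_⟩, ⟨_, hvne i1, ?_⟩,
    fun z => ?_⟩
  · rw [spectralCond, Matrix.inv_eq_right_inv hinv, hnorm, hn2]
    nth_rewrite 1 [hMU]
    rw [hnorm, hn1, div_eq_mul_inv]
  · rw [hM.mulVec_eigenvectorBasis i0]; ext j; simp [hev]
  · rw [hM.mulVec_eigenvectorBasis i1]; ext j; simp [hev]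
  · set y := star U *ᵥ z with hy
    have hstar : star y = star z ᵥ* U := by
      rw [hy, Matrix.star_mulVec, Matrix.star_eq_conjTranspose, Matrix.conjTranspose_conjTranspose]
    have h1 : star z ⬝ᵥ M *ᵥ z = star y ⬝ᵥ D *ᵥ y := by
      rw [hstar, hy, hMU, ← Matrix.mulVec_mulVec, ← Matrix.mulVec_mulVec, Matrix.dotProduct_mulVec]
    have h2 : star z ⬝ᵥ z = star y ⬝ᵥ y := by
      rw [hstar, hy, ← Matrix.dotProduct_mulVec, Matrix.mulVec_mulVec, hUU, Matrix.one_mulVec]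
    have h3 : (star y ⬝ᵥ y).re = ∑ i, Complex.normSq (y i) := by
      simp only [dotProduct, Complex.re_sum, Pi.star_apply]
      refine Finset.sum_congr rfl fun i _ => ?_
      rw [mul_comm, ← starRingEnd_apply, Complex.mul_conj, Complex.ofReal_re]
    have h4 : (star y ⬝ᵥ D *ᵥ y).re = ∑ i, ev i * Complex.normSq (y i) := by
      simp only [dotProduct, Complex.re_sum, Pi.star_apply, hD, Matrix.mulVec_diagonal]
      refine Finset.sum_congr rfl fun i _ => ?_
      rw [mul_left_comm, mul_comm (star (y i)), ← starRingEnd_apply, Complex.mul_conj,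
        ← Complex.ofReal_re (ev i * Complex.normSq (y i))]
      push_cast; rfl
    rw [h1, h2, h3, h4, Finset.mul_sum, Finset.mul_sum]
    exact ⟨Finset.sum_le_sum fun i _ => mul_le_mul_of_nonneg_right (hi0 i) (Complex.normSq_nonneg _),
      Finset.sum_le_sum fun i _ => mul_le_mul_of_nonneg_right (hi1 i) (Complex.normSq_nonneg _)⟩

/-! ### The mass matrix and its real quadratic form. -/

/-- The entries of the mass matrix as real integrals. -/
def massEntry (α : ℝ) (m n : ℕ) : ℝ :=
  ∫ x in (-1 : ℝ)..1, (basisConst α m * (wt α x * jacobiP α α m x)) *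
    (basisConst α n * (wt α x * jacobiP α α n x))

theorem massEntry_comm (α : ℝ) (m n : ℕ) : massEntry α m n = massEntry α n m := by
  unfold massEntry; congr 1; ext x; ring

theorem continuous_massEntry {α : ℝ} (hα : 0 < α) (m n : ℕ) :
    Continuous fun x => (basisConst α m * (wt α x * jacobiP α α m x)) *
      (basisConst α n * (wt α x * jacobiP α α n x)) :=
  (continuous_const.mul ((continuous_wt hα.le).mul (continuous_jacobiP α m))).mul
    (continuous_const.mul ((continuous_wt hα.le).mul (continuous_jacobiP α n)))

theorem basisFun_mul_conj (α : ℝ) (m n : ℕ) {x : ℝ} (hx : x ∈ Ioo (-1 : ℝ) 1) :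
    basisFun α m x * conj (basisFun α n x)
      = (((basisConst α m * (wt α x * jacobiP α α m x)) *
        (basisConst α n * (wt α x * jacobiP α α n x)) : ℝ) : ℂ) := by
  rw [basisFun_eq_indicator, basisFun_eq_indicator, indicator_of_mem hx, indicator_of_mem hx,
    map_mul, Complex.conj_ofReal, Complex.conj_ofReal]
  push_cast; ring

theorem integrableOn_basisFun_mul_conj {α : ℝ} (hα : 0 < α) (m n : ℕ) :
    IntegrableOn (fun x => basisFun α m x * conj (basisFun α n x)) (Ioo (-1 : ℝ) 1) := by
  have h := ((Complex.continuous_ofReal.comp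
    (continuous_massEntry hα m n)).integrableOn_Icc (μ := volume) (a := -1) (b := 1)).mono_set
    Ioo_subset_Icc_self
  exact h.congr_fun (fun x hx => (basisFun_mul_conj α m n hx).symm) measurableSet_Ioo

theorem formB_basisFun (α : ℝ) (m n : ℕ) :
    formB (basisFun α m) (basisFun α n) = (massEntry α m n : ℂ) := by
  rw [formB, setIntegral_congr_fun measurableSet_Ioo
    (fun x hx => basisFun_mul_conj α m n hx), integral_complex_ofReal, massEntry,
    intervalIntegral.integral_of_le (by norm_num), integral_Ioc_eq_integral_Ioo]

theorem massMatrix_apply (α : ℝ) (N : ℕ) (i j : Fin (N + 1)) :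
    massMatrix α N i j = (massEntry α i j : ℂ) := by
  rw [massMatrix, Matrix.of_apply, formB_basisFun, massEntry_comm]

theorem isHermitian_massMatrix (α : ℝ) (N : ℕ) : (massMatrix α N).IsHermitian := by
  ext i j
  rw [Matrix.conjTranspose_apply, massMatrix_apply, massMatrix_apply, massEntry_comm,
    ← starRingEnd_apply, Complex.conj_ofReal]

open scoped Matrix in
theorem formB_sum {α : ℝ} (hα : 0 < α) (N : ℕ) (z w : Fin (N + 1) → ℂ) :
    formB (∑ i, z i • basisFun α i) (∑ i, w i • basisFun α i)
      = star w ⬝ᵥ massMatrix α N *ᵥ z := by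
  have e : ∀ x, (∑ i, z i • basisFun α i) x * conj ((∑ i, w i • basisFun α i) x)
      = ∑ i : Fin (N + 1), ∑ j : Fin (N + 1),
        conj (w i) * z j * (basisFun α j x * conj (basisFun α i x)) := by
    intro x
    simp only [Finset.sum_apply, Pi.smul_apply, smul_eq_mul, map_sum, map_mul]
    rw [mul_comm, Finset.sum_mul_sum]
    refine Finset.sum_congr rfl fun i _ => Finset.sum_congr rfl fun j _ => ?_
    ring
  have hint : ∀ i j : Fin (N + 1), IntegrableOn (fun x =>
      conj (w i) * z j * (basisFun α j x * conj (basisFun α i x))) (Ioo (-1 : ℝ) 1) :=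
    fun i j => (integrableOn_basisFun_mul_conj hα j i).const_mul _
  simp only [formB, e]
  rw [integral_finsetSum _ fun i _ => integrable_finsetSum _ fun j _ => hint i j]
  simp only [dotProduct, Matrix.mulVec, Finset.mul_sum, Pi.star_apply]
  refine Finset.sum_congr rfl fun i _ => ?_
  rw [integral_finsetSum _ fun j _ => hint i j]
  refine Finset.sum_congr rfl fun j _ => ?_
  rw [integral_const_mul]
  change conj (w i) * z j * formB (basisFun α j) (basisFun α i) = _
  rw [formB_basisFun, massMatrix_apply, massEntry_comm, ← starRingEnd_apply]
  ring

theorem massForm_eq_sum {α : ℝ} (hα : 0 < α) (N : ℕ) (u : ℕ → ℝ) :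
    massForm α N u = ∑ i : Fin (N + 1), ∑ j : Fin (N + 1), u i * u j * massEntry α i j := by
  have e : ∀ x ∈ uIcc (-1 : ℝ) 1,
      wt (2 * α) x * jacobiComb α N (fun n => u n * basisConst α n) x ^ 2
      = ∑ i : Fin (N + 1), ∑ j : Fin (N + 1), u i * u j *
        ((basisConst α i * (wt α x * jacobiP α α i x)) *
          (basisConst α j * (wt α x * jacobiP α α j x))) := by
    intro x hx
    rw [uIcc_of_le (by norm_num)] at hx
    have h0 : 0 ≤ 1 - x ^ 2 := by nlinarith [hx.1, hx.2]
    have h2 : wt (2 * α) x = wt α x * wt α x := by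
      rw [wt, wt, two_mul, Real.rpow_add_of_nonneg h0 hα.le hα.le]
    rw [jacobiComb, Finset.sum_range, sq, Finset.sum_mul_sum, h2, Finset.mul_sum]
    refine Finset.sum_congr rfl fun i _ => ?_
    rw [Finset.mul_sum]
    exact Finset.sum_congr rfl fun j _ => by ring
  have hc : ∀ i j : Fin (N + 1), Continuous fun x => u i * u j *
        ((basisConst α i * (wt α x * jacobiP α α i x)) *
          (basisConst α j * (wt α x * jacobiP α α j x))) := fun i j =>
    continuous_const.mul (continuous_massEntry hα i j)
  rw [massForm, intervalIntegral.integral_congr e, intervalIntegral.integral_finsetSum fun i _ =>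
    (continuous_finsetSum _ fun j _ => hc i j).intervalIntegrable _ _]
  refine Finset.sum_congr rfl fun i _ => ?_
  rw [intervalIntegral.integral_finsetSum fun j _ => (hc i j).intervalIntegrable _ _]
  refine Finset.sum_congr rfl fun j _ => ?_
  rw [intervalIntegral.integral_const_mul, massEntry]

/-- Extension of a finite family by zero to a sequence. -/
def extendZero {N : ℕ} (f : Fin (N + 1) → ℝ) (n : ℕ) : ℝ :=
  if h : n < N + 1 then f ⟨n, h⟩ else 0

theorem extendZero_coe {N : ℕ} (f : Fin (N + 1) → ℝ) (i : Fin (N + 1)) :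
    extendZero f i = f i := dif_pos i.isLt

-- The matrix is real symmetric, so the cross terms between real and imaginary parts cancel and the
-- real bounds on `massForm` carry over to complex vectors.
open scoped Matrix in
theorem re_massMatrix {α : ℝ} (hα : 0 < α) (N : ℕ) (z : Fin (N + 1) → ℂ) :
    (star z ⬝ᵥ massMatrix α N *ᵥ z).re
      = massForm α N (extendZero fun i => (z i).re)
        + massForm α N (extendZero fun i => (z i).im) := by
  rw [massForm_eq_sum hα, massForm_eq_sum hα, ← Finset.sum_add_distrib]
  simp only [dotProduct, Matrix.mulVec, Finset.mul_sum, Pi.star_apply, Complex.re_sum,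
    extendZero_coe, ← Finset.sum_add_distrib]
  refine Finset.sum_congr rfl fun i _ => Finset.sum_congr rfl fun j _ => ?_
  rw [massMatrix_apply]
  simp only [Complex.mul_re, Complex.mul_im, Complex.ofReal_re, Complex.ofReal_im,
    Complex.star_def, Complex.conj_re, Complex.conj_im]
  ring

theorem re_star_dotProduct_self {N : ℕ} (z : Fin (N + 1) → ℂ) :
    (star z ⬝ᵥ z).re = ∑ n ∈ Finset.range (N + 1), extendZero (fun i => (z i).re) n ^ 2
      + ∑ n ∈ Finset.range (N + 1), extendZero (fun i => (z i).im) n ^ 2 := by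
  rw [Finset.sum_range, Finset.sum_range, ← Finset.sum_add_distrib]
  simp only [dotProduct, Pi.star_apply, Complex.re_sum, extendZero_coe]
  refine Finset.sum_congr rfl fun i _ => ?_
  simp only [Complex.mul_re, Complex.star_def, Complex.conj_re, Complex.conj_im]
  ring

theorem re_star_dotProduct_self_pos {n : ℕ} {z : Fin n → ℂ} (hz : z ≠ 0) :
    0 < (star z ⬝ᵥ z).re := by
  have h : (star z ⬝ᵥ z).re = ∑ i, Complex.normSq (z i) := by
    simp only [dotProduct, Complex.re_sum, Pi.star_apply]
    refine Finset.sum_congr rfl fun i _ => ?_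
    rw [mul_comm, ← starRingEnd_apply, Complex.mul_conj, Complex.ofReal_re]
  rw [h]
  obtain ⟨i, hi⟩ := Function.ne_iff.1 hz
  exact Finset.sum_pos' (fun i _ => Complex.normSq_nonneg _)
    ⟨i, Finset.mem_univ i, Complex.normSq_pos.2 hi⟩

/-! ### The discrete eigenvalues. -/

theorem mem_approxSpace_iff {α : ℝ} {N : ℕ} {u : ℝ → ℂ} :
    u ∈ approxSpace α N ↔ ∃ z : Fin (N + 1) → ℂ, ∑ i, z i • basisFun α i = u :=
  Submodule.mem_span_range_iff_exists_fun ℂ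

/-- Linear independence, from the positivity of `a` on nonzero coefficient vectors. -/
theorem sum_basisFun_ne_zero {α : ℝ} (hα : 0 < α) {N : ℕ} {z : Fin (N + 1) → ℂ} (hz : z ≠ 0) :
    ∑ i, z i • basisFun α i ≠ 0 := by
  intro h
  have h1 := formA_sum hα N z z
  have h2 := formA_sum hα N 0 0
  simp only [Pi.zero_apply, zero_smul, Finset.sum_const_zero, zero_mul, mul_zero] at h2
  rw [h, h2] at h1
  have h3 : ∑ i, z i * conj (z i) = star z ⬝ᵥ z := by
    simp only [dotProduct, Pi.star_apply]
    exact Finset.sum_congr rfl fun i _ => by rw [mul_comm]; rfl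
  have h4 := (mul_eq_zero.1 h1.symm).resolve_left (by exact_mod_cast (stiffConst_pos hα).ne')
  have h5 := re_star_dotProduct_self_pos hz
  rw [← h3, h4] at h5
  simp at h5

-- Since the stiffness matrix is `κ I`, the generalised problem is `κ z = λ M z`.
open scoped Matrix in
theorem mem_discreteEigenvalues_iff {α : ℝ} (hα : 0 < α) {N : ℕ} {lam : ℝ} :
    lam ∈ discreteEigenvalues α N ↔ ∃ z : Fin (N + 1) → ℂ, z ≠ 0 ∧
      (stiffConst α : ℂ) • z = (lam : ℂ) • (massMatrix α N *ᵥ z) := by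
  have key : ∀ z w : Fin (N + 1) → ℂ, formA α (∑ i, z i • basisFun α i)
      (∑ i, w i • basisFun α i) = star w ⬝ᵥ ((stiffConst α : ℂ) • z) := fun z w => by
    rw [formA_sum hα, dotProduct_smul, smul_eq_mul]
    congr 1
    exact Finset.sum_congr rfl fun i _ => mul_comm _ _
  constructor
  · rintro ⟨u, hu, hu0, h⟩
    obtain ⟨z, rfl⟩ := mem_approxSpace_iff.1 hu
    refine ⟨z, fun hz => hu0 (by simp [hz]), ?_⟩
    rw [← sub_eq_zero]
    -- Testing with the residual itself shows that its norm is zero.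
    set w := (stiffConst α : ℂ) • z - (lam : ℂ) • (massMatrix α N *ᵥ z) with hw
    have h1 := h _ (mem_approxSpace_iff.2 ⟨w, rfl⟩)
    rw [key, formB_sum hα, ← smul_eq_mul, ← dotProduct_smul, ← sub_eq_zero,
      ← dotProduct_sub, ← hw] at h1
    by_contra hne
    exact (re_star_dotProduct_self_pos hne).ne' (by rw [h1, Complex.zero_re])
  · rintro ⟨z, hz, h⟩
    refine ⟨_, mem_approxSpace_iff.2 ⟨z, rfl⟩, sum_basisFun_ne_zero hα hz, fun v hv => ?_⟩
    obtain ⟨w, rfl⟩ := mem_approxSpace_iff.1 hv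
    rw [key, formB_sum hα, h, dotProduct_smul, smul_eq_mul]

theorem approxSpace_subset_HStar {α : ℝ} (hα : 0 < α) (N : ℕ) :
    (approxSpace α N : Set (ℝ → ℂ)) ⊆ HStar α := by
  intro u hu
  obtain ⟨z, rfl⟩ := mem_approxSpace_iff.1 hu
  refine ⟨?_, memLp_rieszSymbolMul_sum hα N z⟩
  have h : ∀ n, MemLp (basisFun α n) 2 (volume.restrict (Ioo (-1 : ℝ) 1)) := fun n => by
    rw [memLp_two_iff_integrable_sq_norm (integrable_basisFun hα n).1.restrict]
    refine (integrableOn_basisFun_mul_conj hα n n).norm.congr (Eventually.of_forall fun x => ?_)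
    simp [sq]
  have e : (∑ i, z i • basisFun α i) = fun x => ∑ i : Fin (N + 1), z i * basisFun α i x := by
    ext x; simp
  rw [e]
  exact memLp_finsetSum _ fun i _ => (h i).const_mul _

open scoped Matrix in
/-- The extreme discrete eigenvalues and the bounds for the extreme eigenvalues of the mass
matrix. -/
theorem exists_extreme_discreteEigenvalues {α : ℝ} (hα : 0 < α) :
    ∃ c C d D : ℝ, 0 < c ∧ 0 < C ∧ 0 < d ∧ 0 < D ∧ ∀ N : ℕ, ∃ a b : ℝ, 0 < a ∧ 0 < b ∧
      IsUnit (massMatrix α N) ∧ spectralCond (massMatrix α N) = b / a ∧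
      IsLeast (discreteEigenvalues α N) (stiffConst α / b) ∧
      IsGreatest (discreteEigenvalues α N) (stiffConst α / a) ∧
      c * ((N : ℝ) + 1) ^ (-(4 * α)) ≤ a ∧ a ≤ C * ((N : ℝ) + 1) ^ (-(4 * α)) ∧
      d ≤ b ∧ b ≤ D := by
  obtain ⟨c, hc, hlow⟩ := exists_le_massForm hα
  obtain ⟨D, hD, hup⟩ := exists_massForm_le hα
  obtain ⟨C, hC, htest⟩ := exists_massForm_le_of_kernel hα
  have hκ := stiffConst_pos hα
  have hd : 0 < massEntry α 0 0 := by
    have h := hlow 0 (fun _ => 1)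
    rw [massForm_eq_sum hα] at h
    simp at h
    linarith
  refine ⟨c, C, massEntry α 0 0, D, hc, hC, hd, hD, fun N => ?_⟩
  have hlowz : ∀ z : Fin (N + 1) → ℂ, c * ((N : ℝ) + 1) ^ (-(4 * α)) * (star z ⬝ᵥ z).re
      ≤ (star z ⬝ᵥ massMatrix α N *ᵥ z).re := fun z => by
    rw [re_massMatrix hα, re_star_dotProduct_self, mul_add]
    exact add_le_add (hlow N _) (hlow N _)
  have hcN : 0 < c * ((N : ℝ) + 1) ^ (-(4 * α)) := by positivity
  obtain ⟨a, b, ha, hb, hunit, hcond, ⟨za, hza, hMa⟩, ⟨zb, hzb, hMb⟩, hray⟩ :=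
    (isHermitian_massMatrix α N).exists_extreme_eigenvalues fun z hz =>
      (mul_pos hcN (re_star_dotProduct_self_pos hz)).trans_le (hlowz z)
  have hbounds : ∀ lam ∈ discreteEigenvalues α N,
      stiffConst α / b ≤ lam ∧ lam ≤ stiffConst α / a := by
    intro lam hlam
    obtain ⟨z, hz, h⟩ := (mem_discreteEigenvalues_iff hα).1 hlam
    have h1 := congrArg (fun y => (star z ⬝ᵥ y).re) h
    simp only [dotProduct_smul, smul_eq_mul, Complex.re_ofReal_mul] at h1
    have hS := re_star_dotProduct_self_pos hz
    obtain ⟨h2, h3⟩ := hray z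
    set S := (star z ⬝ᵥ z).re
    set q := (star z ⬝ᵥ massMatrix α N *ᵥ z).re
    have hq : 0 < q := (mul_pos ha hS).trans_le h2
    -- Here `λ` is `κ` over the Rayleigh quotient of `M` at the eigenvector, so the Rayleigh bounds
    -- are inverted.
    have hl : lam = stiffConst α * S / q := by rw [eq_div_iff hq.ne', h1]
    rw [hl, div_le_div_iff₀ hb hq, div_le_div_iff₀ hq ha]
    constructor
    · nlinarith
    · nlinarith
  have hmem : ∀ (r : ℝ) (z : Fin (N + 1) → ℂ), 0 < r → z ≠ 0 →
      massMatrix α N *ᵥ z = (r : ℂ) • z → stiffConst α / r ∈ discreteEigenvalues α N := by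
    intro r z hr hz h
    refine (mem_discreteEigenvalues_iff hα).2 ⟨z, hz, ?_⟩
    have : (r : ℂ) ≠ 0 := by exact_mod_cast hr.ne'
    rw [h, smul_smul]
    push_cast
    rw [div_mul_cancel₀ _ this]
  refine ⟨a, b, ha, hb, hunit, hcond, ⟨hmem b zb hb hzb hMb, fun l hl => (hbounds l hl).1⟩,
    ⟨hmem a za ha hza hMa, fun l hl => (hbounds l hl).2⟩, ?_, ?_, ?_, ?_⟩
  · have h := hlowz za
    rw [hMa, dotProduct_smul, smul_eq_mul, Complex.re_ofReal_mul] at h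
    exact le_of_mul_le_mul_right h (re_star_dotProduct_self_pos hza)
  · obtain ⟨u, hu, hle⟩ := htest N
    set z : Fin (N + 1) → ℂ := fun i => (u i : ℂ) with hz
    have h := (hray z).1
    have e1 : massForm α N (extendZero fun i => (z i).re) = massForm α N u := by
      rw [massForm_eq_sum hα, massForm_eq_sum hα]
      simp only [extendZero_coe, hz, Complex.ofReal_re]
    have e2 : massForm α N (extendZero fun i => (z i).im) = 0 := by
      rw [massForm_eq_sum hα]
      simp [extendZero_coe, hz]
    have e3 : (star z ⬝ᵥ z).re = ∑ n ∈ Finset.range (N + 1), u n ^ 2 := by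
      rw [re_star_dotProduct_self, Finset.sum_range, Finset.sum_range, Finset.sum_range]
      simp [extendZero_coe, hz]
    rw [re_massMatrix hα, e1, e2, e3, add_zero] at h
    exact le_of_mul_le_mul_right (h.trans hle) hu
  -- The first coordinate vector tests the largest eigenvalue: its Rayleigh quotient is `M_00`, the
  -- same for every `N`.
  · have h := (hray (Pi.single 0 1)).2
    simpa [massMatrix_apply] using h
  · have h : (star zb ⬝ᵥ massMatrix α N *ᵥ zb).re ≤ D * (star zb ⬝ᵥ zb).re := by
      rw [re_massMatrix hα, re_star_dotProduct_self, mul_add]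
      exact add_le_add (hup N _) (hup N _)
    rw [hMb, dotProduct_smul, smul_eq_mul, Complex.re_ofReal_mul] at h
    exact le_of_mul_le_mul_right h (re_star_dotProduct_self_pos hzb)

/-! ### Passage to asymptotic equivalence and the main theorem. -/

theorem isTheta_of_bounds {f g : ℕ → ℝ} {c C : ℝ} (hc : 0 < c) (hg : ∀ n, 0 < g n)
    (h : ∀ᶠ n in atTop, c * g n ≤ f n ∧ f n ≤ C * g n) : f =Θ[atTop] g := by
  constructor
  · refine IsBigO.of_bound C ?_
    filter_upwards [h] with n hn
    have : 0 < f n := (mul_pos hc (hg n)).trans_le hn.1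
    rw [Real.norm_eq_abs, Real.norm_eq_abs, abs_of_pos this, abs_of_pos (hg n)]
    exact hn.2
  · refine IsBigO.of_bound c⁻¹ ?_
    filter_upwards [h] with n hn
    have : 0 < f n := (mul_pos hc (hg n)).trans_le hn.1
    rw [Real.norm_eq_abs, Real.norm_eq_abs, abs_of_pos this, abs_of_pos (hg n), inv_mul_eq_div,
      le_div_iff₀ hc, mul_comm]
    exact hn.1

theorem isTheta_add_one_rpow {s : ℝ} (hs : 0 ≤ s) :
    (fun N : ℕ => ((N : ℝ) + 1) ^ s) =Θ[atTop] fun N : ℕ => (N : ℝ) ^ s := by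
  constructor
  · refine IsBigO.of_bound (2 ^ s) ?_
    filter_upwards [eventually_ge_atTop 1] with N hN
    have hN' : (1 : ℝ) ≤ N := by exact_mod_cast hN
    rw [Real.norm_eq_abs, Real.norm_eq_abs, abs_of_pos (by positivity),
      abs_of_nonneg (by positivity), ← Real.mul_rpow (by norm_num) (by positivity)]
    exact Real.rpow_le_rpow (by positivity) (by linarith) hs
  · refine IsBigO.of_bound 1 (Eventually.of_forall fun N => ?_)
    rw [Real.norm_eq_abs, Real.norm_eq_abs, abs_of_nonneg (by positivity),
      abs_of_pos (by positivity), one_mul]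
    exact Real.rpow_le_rpow (by positivity) (by linarith) hs

end

theorem mainTheorem2 (α : ℝ) (hα : 0 < α) :
    (∀ N : ℕ, (approxSpace α N : Set (ℝ → ℂ)) ⊆ HStar α) ∧
    (∀ N : ℕ, IsUnit (massMatrix α N)) ∧
    ∃ lamMin lamMax : ℕ → ℝ,
      (∀ N : ℕ, 0 < lamMin N) ∧
      (∀ N : ℕ, IsLeast (discreteEigenvalues α N) (lamMin N)) ∧
      (∀ N : ℕ, IsGreatest (discreteEigenvalues α N) (lamMax N)) ∧
      lamMin =Θ[atTop] (fun _ : ℕ => (1 : ℝ)) ∧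
      lamMax =Θ[atTop] (fun N : ℕ => (N : ℝ) ^ (4 * α)) ∧
      (∀ N : ℕ, spectralCond (massMatrix α N) = lamMax N / lamMin N) ∧
      (fun N : ℕ => spectralCond (massMatrix α N)) =Θ[atTop]
        (fun N : ℕ => (N : ℝ) ^ (4 * α)) := by
  obtain ⟨c, C, d, D, hc, hC, hd, hD, h⟩ := exists_extreme_discreteEigenvalues hα
  choose a b ha hb hunit hcond hleast hgreat ha1 ha2 hb1 hb2 using h
  have hκ := stiffConst_pos hα
  -- The constant `κ` cancels, so the quotient of extreme discrete eigenvalues is that of the mass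
  -- matrix.
  have hcondEq : ∀ N, spectralCond (massMatrix α N)
      = stiffConst α / a N / (stiffConst α / b N) := fun N => by
    have := ha N
    have := hb N
    rw [hcond]; field_simp
  have hmin : (fun N => stiffConst α / b N) =Θ[atTop] (fun _ : ℕ => (1 : ℝ)) := by
    refine isTheta_of_bounds (c := stiffConst α / D) (C := stiffConst α / d) (by positivity)
      (fun _ => one_pos) (Eventually.of_forall fun N => ?_)
    rw [mul_one, mul_one]
    exact ⟨div_le_div_of_nonneg_left hκ.le (hb N) (hb2 N),
      div_le_div_of_nonneg_left hκ.le hd (hb1 N)⟩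
  have hmax : (fun N => stiffConst α / a N) =Θ[atTop] (fun N : ℕ => (N : ℝ) ^ (4 * α)) := by
    refine IsTheta.trans ?_ (isTheta_add_one_rpow (s := 4 * α) (by linarith))
    refine isTheta_of_bounds (c := stiffConst α / C) (C := stiffConst α / c) (by positivity)
      (fun N => by positivity) (Eventually.of_forall fun N => ?_)
    have hp : (0 : ℝ) < ((N : ℝ) + 1) ^ (4 * α) := by positivity
    have e : ∀ K : ℝ, stiffConst α / K * ((N : ℝ) + 1) ^ (4 * α)
        = stiffConst α / (K * ((N : ℝ) + 1) ^ (-(4 * α))) := fun K => by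
      rw [Real.rpow_neg (by positivity)]; field_simp
    rw [e, e]
    exact ⟨div_le_div_of_nonneg_left hκ.le (ha N) (ha2 N),
      div_le_div_of_nonneg_left hκ.le (by positivity) (ha1 N)⟩
  refine ⟨approxSpace_subset_HStar hα, hunit, fun N => stiffConst α / b N,
    fun N => stiffConst α / a N, fun N => div_pos hκ (hb N), hleast, hgreat, hmin, hmax,
    hcondEq, ?_⟩
  simp only [hcondEq]
  simpa using hmax.div hmin
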